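/- **Setting.** Let $k,m\ge 0$ and $d_1,\dots,d_k\ge 0$ be integers, let $\mathcal M_i:\mathbb R^m\to\mathbb R^m$ and $\mathcal H_i:\mathbb R^m\to\mathbb R^{d_i}$ ($i=1,\dots,k$) be continuously differentiable, let $x_{\mathrm b},\mu_i\in\mathbb R^m$, $y_i\in\mathbb R^{d_i}$, let $B,Q_i\in\mathbb R^{m\times m}$ and $R_i\in\mathbb R^{d_i\times d_i}$ be symmetric positive definite, and let $\gamma>0$. Write $|v|_A^2=v^{\mathrm T}Av$, and let $x^0=x^0_{0:k}=(x^0_0,\dots,x^0_k)\in(\mathbb R^m)^{k+1}$ be arbitrary. **Exact Levenberg–Marquardt (LM) algorithm.** For $j=1,2,\dots$, $x^j=x^j_{0:k}$ is the minimizer over $x_{0:k}\in(\mathbb R^m)^{k+1}$ of $$|x_0-x_{\mathrm b}|_{B^{-1}}^2+\sum_{i=1}^k\bigl|x_i-\mathcal M_i(x_{i-1}^{j-1})-\mathcal M_i'(x_{i-1}^{j-1})(x_{i-1}-x_{i-1}^{j-1})-\mu_i\bigr|_{Q_i^{-1}}^2+\sum_{i=1}^k\bigl|y_i-\mathcal H_i(x_i^{j-1})-\mathcal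 H_i'(x_i^{j-1})(x_i-x_i^{j-1})\bigr|_{R_i^{-1}}^2+\sum_{i=1}^k\gamma|x_i-x_i^{j-1}|^2 .$$ **EnKS-4DVAR.** For $f:\mathbb R^p\to\mathbb R^q$ and $\tau>0$ put $\delta_\tau f(x)[v]=\bigl(f(x+\tau v)-f(x)\bigr)/\tau$. Let $\tilde{\mathcal H}_i(x)=\begin{bmatrix}\mathcal H_i(x)\\ x\end{bmatrix}$ and $\tilde R_i=\begin{bmatrix}R_i&0\\0&\gamma^{-1}I_m\end{bmatrix}$. On a probability space let $X_0^{j,n}\sim N(x_{\mathrm b},B)$, $V_i^{j,n}\sim N(0,Q_i)$ and $\tilde W_i^{j,n}\sim N(0,\tilde R_i)$ ($j,n\ge 1$, $1\le i\le k$) be random vectors such that, for each fixed $j$, all of them (over all $n$ and $i$) are mutually independent. Given $\tau>0$ and ensemble sizes $N_1,N_2,\dots$, set $\bar X^{0,N,\tau}_{0:k|k}=x^0$. For $j\ge1$ write $z=\bar X^{j-1,N,\tau}_{0:k|k}$, start from $X_{0|0}^{n}=X_0^{j,n}$, $n=1,\dots,N_j$, and for $i=1,\dots,k$ compute the forecast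 $$X_{i|i-1}^{n}=\delta_\tau\mathcal M_i(z_{i-1})[X_{i-1|i-1}^{n}-z_{i-1}]+\mathcal M_i(z_{i-1})+\mu_i+V_i^{j,n},\qquad X_{0:i|i-1}^n=(X_{0:i-1|i-1}^n,X_{i|i-1}^n),$$ and the analysis $$X_{0:i|i}^{n}=X_{0:i|i-1}^{n}+G_i\,(S_i+\tilde R_i)^{-1}\Bigl(\begin{bmatrix}y_i\\ z_i\end{bmatrix}-\tilde W_i^{j,n}-\tilde{\mathcal H}_i(z_i)-\delta_\tau\tilde{\mathcal H}_i(z_i)[X_{i|i-1}^{n}-z_i]\Bigr),$$ where, with bars denoting sample means over $n=1,\dots,N_j$, $$h^n=\delta_\tau\tilde{\mathcal H}_i(z_i)[X_{i|i-1}^n-\bar X_{i|i-1}],\quad G_i=\frac1{N_j-1}\sum_{n=1}^{N_j}(X_{0:i|i-1}^n-\bar X_{0:i|i-1})(h^n)^{\mathrm T},\quad S_i=\frac1{N_j-1}\sum_{n=1}^{N_j}h^n(h^n)^{\mathrm T}.$$ The $j$-th iterate $\bar X^{j,N,\tau}_{0:k|k}$ is the sample mean of $X^1_{0:k|k},\dots,X^{N_j}_{0:k|k}$.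 **Statement.** The LM iterates $x^1,x^2,\dots$ are well defined (each least squares problem has a unique solution), and for each $j\ge1$, $$\lim_{\min\{N_1,\dots,N_j\}\to\infty}\ \lim_{\tau\to0^+}\ \bar X^{j,N,\tau}_{0:k|k}=x^j\quad\text{in probability};$$ that is, for all ensemble sizes $N_1,\dots,N_j\ge2$ the sample mean $\bar X^{j,N,\tau}_{0:k|k}$ converges in probability, as $\tau\to0^+$, to a random vector $Y^{j,N}$, and $Y^{j,N}\to x^j$ in probability as $\min\{N_1,\dots,N_j\}\to\infty$. -/

import Mathlib

open scoped Topology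

noncomputable section

namespace EnKS

/-- The state space `ℝᵐ` with the Euclidean norm. -/
abbrev State (m : ℕ) : Type := EuclideanSpace ℝ (Fin m)

/-- Composite states `x_{0:k} = (x₀, …, x_k)`, with the Euclidean norm of `ℝ^{(k+1)m}`. -/
abbrev Trajectory (k m : ℕ) : Type := PiLp 2 (fun _ : Fin (k + 1) => State m)

/-- The space `ℝ^{d} × ℝᵐ` of augmented observations (an observation and a copy of the state). -/
abbrev AugObs (d m : ℕ) : Type := EuclideanSpace ℝ (Fin d ⊕ Fin m)

/-- The stacked vector `[a; b]`. -/
def stack {d m : ℕ} (a : EuclideanSpace ℝ (Fin d)) (b : State m) : AugObs d m :=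
  WithLp.toLp 2 (Sum.elim (fun r => a r) (fun r => b r))

/-- The weighted square `|v|²_A = vᵀ A v`. -/
def wsq {ι : Type} [Fintype ι] (A : Matrix ι ι ℝ) (v : EuclideanSpace ℝ ι) : ℝ :=
  dotProduct v.ofLp (A.mulVec v.ofLp)

/-- The data of the (weak constraint, 4DVAR) data assimilation problem with `k` time steps and
state dimension `m`. The index `i : Fin k` of the families stands for the time `i + 1`, that is,
`model i` is the model operator from time `i` to time `i + 1`, and `obsOp i`, `y i` are the
observation operator and the observed data (in `ℝ^{d i}`) at time `i + 1`. -/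
structure Problem (k m : ℕ) (d : Fin k → ℕ) where
  /-- background state `x_b` -/
  xb : State m
  /-- background covariance -/
  B : Matrix (Fin m) (Fin m) ℝ
  /-- model operators -/
  model : Fin k → State m → State m
  /-- deterministic model shifts -/
  μ : Fin k → State m
  /-- model error covariances -/
  Q : Fin k → Matrix (Fin m) (Fin m) ℝ
  /-- observation operators -/
  obsOp : ∀ i : Fin k, State m → EuclideanSpace ℝ (Fin (d i))
  /-- observed data -/
  y : ∀ i : Fin k, EuclideanSpace ℝ (Fin (d i))
  /-- observation error covariances -/
  R : ∀ i : Fin k, Matrix (Fin (d i)) (Fin (d i)) ℝ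
  /-- penalty parameter -/
  γ : ℝ

namespace Problem

variable {k m : ℕ} {d : Fin k → ℕ}

/-! ### The exact Levenberg–Marquardt method -/

/-- The linearized and penalized least squares objective at the previous iterate `z`. -/
def objective (D : Problem k m d) (z x : Trajectory k m) : ℝ :=
  wsq D.B⁻¹ (x 0 - D.xb)
    + ∑ i : Fin k, wsq (D.Q i)⁻¹
        (x i.succ - D.model i (z i.castSucc)
          - fderiv ℝ (D.model i) (z i.castSucc) (x i.castSucc - z i.castSucc) - D.μ i)
    + ∑ i : Fin k, wsq (D.R i)⁻¹
        (D.y i - D.obsOp i (z i.succ)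
          - fderiv ℝ (D.obsOp i) (z i.succ) (x i.succ - z i.succ))
    + ∑ i : Fin k, D.γ * ‖x i.succ - z i.succ‖ ^ 2

/-- `x⁰, x¹, x², …` are the iterates of the Levenberg–Marquardt method started at `x0`: each
iterate is a global minimizer of the least squares objective linearized at the previous one. -/
def IsLMSequence (D : Problem k m d) (x0 : Trajectory k m) (x : ℕ → Trajectory k m) : Prop :=
  x 0 = x0 ∧ ∀ j : ℕ, IsMinOn (D.objective (x j)) Set.univ (x (j + 1))

/-! ### The EnKS-4DVAR method -/

/-- The augmented observation operator `x ↦ [𝓗(x); x]`. -/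
def augObsOp (D : Problem k m d) (i : Fin k) (x : State m) : AugObs (d i) m :=
  stack (D.obsOp i x) x

/-- The augmented observation error covariance `diag(R, γ⁻¹ I)`. -/
def augR (D : Problem k m d) (i : Fin k) : Matrix (Fin (d i) ⊕ Fin m) (Fin (d i) ⊕ Fin m) ℝ :=
  Matrix.fromBlocks (D.R i) 0 0 (D.γ⁻¹ • (1 : Matrix (Fin m) (Fin m) ℝ))

end Problem

/-- The finite difference `(f (x + τ v) - f x) / τ`. -/
def fd {ι κ : Type} (τ : ℝ) (f : EuclideanSpace ℝ ι → EuclideanSpace ℝ κ)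
    (x v : EuclideanSpace ℝ ι) : EuclideanSpace ℝ κ :=
  τ⁻¹ • (f (x + τ • v) - f x)

/-- The sample mean of an ensemble of size `N`. -/
def sampleMean {E : Type} [AddCommGroup E] [Module ℝ E] {N : ℕ} (X : Fin N → E) : E :=
  (N : ℝ)⁻¹ • ∑ n, X n

/-- The normalized sum of outer products `(N - 1)⁻¹ ∑ₙ aₙ bₙᵀ`. -/
def sampleOuter {ι κ : Type} {N : ℕ} (a : Fin N → EuclideanSpace ℝ ι)
    (b : Fin N → EuclideanSpace ℝ κ) : Matrix ι κ ℝ :=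
  ((N : ℝ) - 1)⁻¹ • ∑ n, Matrix.vecMulVec (a n).ofLp (b n).ofLp

/-- The random perturbations of one ensemble member in one iteration: the initial state, the model
errors `V_i` and the (augmented) observation errors `W̃_i`. -/
inductive Source (k : ℕ) : Type
  | init : Source k
  | model (i : Fin k) : Source k
  | obs (i : Fin k) : Source k

/-- The coordinates of the perturbation of each kind. -/
@[reducible] def Source.Coord {k : ℕ} (m : ℕ) (d : Fin k → ℕ) : Source k → Type
  | .init => Fin m
  | .model _ => Fin m
  | .obs i => Fin (d i) ⊕ Fin m

/-- The Euclidean space in which the perturbation of each kind takes its values. -/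
abbrev Noise {k : ℕ} (m : ℕ) (d : Fin k → ℕ) (c : Source k) : Type :=
  EuclideanSpace ℝ (c.Coord m d)

namespace Problem

variable {k m : ℕ} {d : Fin k → ℕ}

/-- Forecast of one member from time `i` to time `i + 1`: the model linearized at the previous
iterate `z`, with the derivative replaced by the finite difference with step `τ`. -/
def forecast (D : Problem k m d) (τ : ℝ) (z : Trajectory k m) (i : Fin k) (v x : State m) :
    State m :=
  fd τ (D.model i) (z i.castSucc) (x - z i.castSucc) + D.model i (z i.castSucc) + D.μ i + v

/-- Analysis step at time `i + 1`, applied to an ensemble `X` of composite states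
`X n = (X_0, …, X_{i+1})`, with observation perturbations `w`. Here `h n` approximates
`H̃ (X_{i+1} - X̄_{i+1})` by a finite difference at the previous iterate `z`; `PHt l` is the block
of time `l` of `P H̃ᵀ`, and `HPHt` is `H̃ P H̃ᵀ`. -/
def analysis (D : Problem k m d) (τ : ℝ) (z : Trajectory k m) (i : Fin k) {N : ℕ}
    (w : Fin N → AugObs (d i) m) (X : Fin N → Fin ((i : ℕ) + 2) → State m) :
    Fin N → Fin ((i : ℕ) + 2) → State m :=
  let last := Fin.last ((i : ℕ) + 1)
  let zi : State m := z i.succ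
  let h : Fin N → AugObs (d i) m := fun n =>
    fd τ (D.augObsOp i) zi (X n last - sampleMean X last)
  let PHt : Fin ((i : ℕ) + 2) → Matrix (Fin m) (Fin (d i) ⊕ Fin m) ℝ := fun l =>
    sampleOuter (fun n => X n l - sampleMean X l) h
  let HPHt : Matrix (Fin (d i) ⊕ Fin m) (Fin (d i) ⊕ Fin m) ℝ := sampleOuter h h
  fun n l => X n l + Matrix.toEuclideanLin (PHt l * (HPHt + D.augR i)⁻¹)
    (stack (D.y i) zi - w n - D.augObsOp i zi - fd τ (D.augObsOp i) zi (X n last - zi))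

/-- The ensemble of composite states `X_{0:i|i}` of size `N` in the ensemble Kalman smoother loop
of one iteration, linearized at the previous iterate `z`, with perturbations `e`. -/
def ensemble (D : Problem k m d) (τ : ℝ) (z : Trajectory k m) (N : ℕ)
    (e : ℕ → (c : Source k) → Noise m d c) :
    (i : ℕ) → i ≤ k → Fin N → Fin (i + 1) → State m
  | 0, _ => fun n _ => e n Source.init
  | i + 1, hi =>
    let X := ensemble D τ z N e i (Nat.le_of_succ_le hi)
    let t : Fin k := ⟨i, hi⟩
    D.analysis τ z t (fun n => e n (Source.obs t))
      (fun n => Fin.snoc (α := fun _ => State m) (X n)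
        (D.forecast τ z t (e n (Source.model t)) (X n (Fin.last i))))

/-- The iterates `X̄^{j,N,τ}_{0:k|k}` of EnKS-4DVAR, with finite difference step `τ`, ensemble size
`N j` in iteration `j ≥ 1`, starting point `x0`, and perturbation `e j n c` of kind `c` of member
`n` (numbered from `0`) in iteration `j ≥ 1`. -/
def iterate (D : Problem k m d) (τ : ℝ) (N : ℕ → ℕ) (x0 : Trajectory k m)
    (e : ℕ → ℕ → (c : Source k) → Noise m d c) : ℕ → Trajectory k m
  | 0 => x0
  | j + 1 => WithLp.toLp 2 (sampleMean
      (D.ensemble τ (D.iterate τ N x0 e j) (N (j + 1)) (e (j + 1)) k le_rfl))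

end Problem

/-- The filter `min {N 1, …, N j} → ∞` on sequences of ensemble sizes (for `j ≥ 1`). -/
def minSizeAtTop (j : ℕ) : Filter (ℕ → ℕ) :=
  Filter.comap (fun N => ⨅ l : Fin j, N ((l : ℕ) + 1)) Filter.atTop

end EnKS

end

/-! For fixed perturbations the algorithm extends continuously to `τ = 0`. The difference quotient
equals the integral of `f'(x + sτv) v` over `s ∈ [0, 1]`, which makes sense at `τ = 0`, and the only
matrices inverted are a positive semidefinite sample covariance plus the positive definite `augR`.
So the inner limit exists for every outcome, and `Y` is the algorithm run with exact derivatives,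
`iterateX 0`.

With exact derivatives, stack all perturbations of member `n` into one vector `U n`. Since the gain
is common to all members, each state of member `n` is `mean + coef (U n - Ū)`, where `mean` and
`coef` depend only on the sample mean `Ū`, the sample covariance and the previous iterate
(`ensembleX_zero_eq`). Averaging removes the deviations, so the new iterate is a function of these
three quantities, continuous wherever the covariance is positive semidefinite (`continuousAt_mean`).
By the strong law the sample moments converge almost surely to the true ones, and induction on the
iteration gives almost sure convergence to the iterates of `estimate`, which is the same formula
with the true moments.

It remains to see that `estimate z` is the unique minimizer of the objective
(`objective_estimate_lt`). A trajectory `x` determines the perturbations `noiseOf z x` that produce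
it and explain the data, and the objective is their squared `C⁻¹`-distance from the mean, with `C =
totalCov`. Minimizing is thus a projection onto an affine subspace. Let `A l` be the final
coefficients and `w` the deviation of `noiseOf z (estimate z)` from the mean. By
`mean_add_coef_noiseOf`, whatever the gain, `A l` recovers differences of trajectories from
differences of perturbations, and `A l w = 0`. By `consistent_coef`, where the gain has to be the
Kalman gain, the columns of `C (A l)ᵀ` are tangent to the subspace; a dimension count shows that
they span its directions. Hence every tangent vector is `v = C ∑ (A l)ᵀ c l`, so `v · C⁻¹ w = ∑ c l
· A l w = 0`, and Pythagoras gives strict minimality. -/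

noncomputable section

namespace EnKS

/-! ### Difference quotients up to zero step. -/

section FiniteDifference

variable {ι κ : Type}

/-- The finite difference quotient `fd τ f x v`, extended by the derivative at `τ = 0`. -/
def fdx [Fintype ι] [Fintype κ] (τ : ℝ) (f : EuclideanSpace ℝ ι → EuclideanSpace ℝ κ)
    (x v : EuclideanSpace ℝ ι) : EuclideanSpace ℝ κ :=
  if τ = 0 then fderiv ℝ f x v else fd τ f x v

variable [Fintype ι] [Fintype κ]

theorem fdx_zero (f : EuclideanSpace ℝ ι → EuclideanSpace ℝ κ) (x v : EuclideanSpace ℝ ι) :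
    fdx 0 f x v = fderiv ℝ f x v := if_pos rfl

theorem fdx_of_ne {τ : ℝ} (hτ : τ ≠ 0) (f : EuclideanSpace ℝ ι → EuclideanSpace ℝ κ) :
    fdx τ f = fd τ f := by
  funext x v
  exact if_neg hτ

/-- The fundamental theorem of calculus along the segment from `x` to `x + τv`; the right-hand side
has no singularity at `τ = 0`. -/
theorem fdx_eq_integral {f : EuclideanSpace ℝ ι → EuclideanSpace ℝ κ} (hf : ContDiff ℝ 1 f)
    (τ : ℝ) (x v : EuclideanSpace ℝ ι) :
    fdx τ f x v = ∫ s in (0 : ℝ)..1, fderiv ℝ f (x + (s * τ) • v) v := by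
  have hc : Continuous (fderiv ℝ f) := hf.continuous_fderiv one_ne_zero
  by_cases hτ : τ = 0
  · simp [hτ, fdx_zero]
  · have h : ∀ s : ℝ, HasDerivAt (fun s : ℝ => τ⁻¹ • f (x + (s * τ) • v))
        (fderiv ℝ f (x + (s * τ) • v) v) s := by
      intro s
      have h1 : HasDerivAt (fun s : ℝ => x + (s * τ) • v) (τ • v) s := by
        simpa using (((hasDerivAt_id s).mul_const τ).smul_const v).const_add x
      have h2 := ((hf.differentiable one_ne_zero _).hasFDerivAt.comp_hasDerivAt s h1).const_smul τ⁻¹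
      simpa [smul_smul, inv_mul_cancel₀ hτ, Function.comp_def, Pi.smul_def] using h2
    rw [intervalIntegral.integral_eq_sub_of_hasDerivAt (fun s _ => h s)
      (Continuous.intervalIntegrable (by fun_prop) _ _), fdx_of_ne hτ]
    simp [fd, smul_sub]

/-- Joint continuity is needed because the base point, the previous iterate, itself moves with `τ`.
-/
theorem continuous_fdx {T : Type*} [TopologicalSpace T]
    {f : EuclideanSpace ℝ ι → EuclideanSpace ℝ κ} (hf : ContDiff ℝ 1 f)
    {τ : T → ℝ} {x v : T → EuclideanSpace ℝ ι} (hτ : Continuous τ) (hx : Continuous x)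
    (hv : Continuous v) : Continuous fun p => fdx (τ p) f (x p) (v p) := by
  have hc : Continuous (fderiv ℝ f) := hf.continuous_fderiv one_ne_zero
  have h : Continuous fun q : ℝ × EuclideanSpace ℝ ι × EuclideanSpace ℝ ι =>
      fdx q.1 f q.2.1 q.2.2 := by
    simp only [fdx_eq_integral hf]
    apply intervalIntegral.continuous_parametric_intervalIntegral_of_continuous'
    simp only [Function.uncurry_def]
    fun_prop
  exact h.comp (hτ.prodMk (hx.prodMk hv))

end FiniteDifference

/-! ### Sample covariances, and continuity of matrix operations. -/

section Matrices

variable {ι κ ι' κ' : Type}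

theorem toEuclideanLin_mul [Fintype ι] [Fintype κ] [DecidableEq ι] [DecidableEq κ]
    (A : Matrix ι' ι ℝ) (B : Matrix ι κ ℝ) (v : EuclideanSpace ℝ κ) :
    Matrix.toEuclideanLin (A * B) v = Matrix.toEuclideanLin A (Matrix.toEuclideanLin B v) := by
  ext a
  simp

theorem sampleOuter_posSemidef [Finite ι] {N : ℕ} (a : Fin N → EuclideanSpace ℝ ι) :
    (sampleOuter a a).PosSemidef := by
  rcases N.eq_zero_or_pos with rfl | hN
  · simpa [sampleOuter] using Matrix.PosSemidef.zero
  -- For `N = 1` the factor is `0⁻¹ = 0`, so no lower bound on the ensemble size is needed.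
  · have h : (0 : ℝ) ≤ ((N : ℝ) - 1)⁻¹ := by
      have : (1 : ℝ) ≤ N := by exact_mod_cast hN
      exact inv_nonneg.2 (by linarith)
    refine Matrix.PosSemidef.smul (Matrix.posSemidef_sum _ fun n _ => ?_) h
    simpa using Matrix.posSemidef_vecMulVec_self_star (a n).ofLp

theorem sampleOuter_toEuclideanLin [Fintype ι] [Fintype κ] [DecidableEq ι] [DecidableEq κ] {N : ℕ}
    (A : Matrix ι' ι ℝ) (B : Matrix κ' κ ℝ)
    (a : Fin N → EuclideanSpace ℝ ι) (b : Fin N → EuclideanSpace ℝ κ) :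
    sampleOuter (fun n => Matrix.toEuclideanLin A (a n)) (fun n => Matrix.toEuclideanLin B (b n))
      = A * sampleOuter a b * B.transpose := by
  simp [sampleOuter, Matrix.mul_sum, Matrix.sum_mul,
    Matrix.mul_vecMulVec, Matrix.vecMulVec_mul, Matrix.vecMul_transpose]

theorem continuousAt_matrix_inv {T : Type*} [TopologicalSpace T] [Fintype ι] [DecidableEq ι]
    {S : T → Matrix ι ι ℝ} {p : T} (hS : ContinuousAt S p) (hp : (S p).PosDef) :
    ContinuousAt (fun q => (S q)⁻¹) p := by
  simp only [Matrix.inv_def, Ring.inverse_eq_inv']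
  have h1 : ContinuousAt (fun q => (S q).det) p :=
    (continuous_id.matrix_det.continuousAt (x := S p)).comp hS
  have h2 : ContinuousAt (fun q => (S q).adjugate) p :=
    (continuous_id.matrix_adjugate.continuousAt (x := S p)).comp hS
  exact (h1.inv₀ hp.det_pos.ne').smul h2

theorem continuous_sampleOuter {T : Type*} [TopologicalSpace T] {N : ℕ}
    {a : T → Fin N → EuclideanSpace ℝ ι} {b : T → Fin N → EuclideanSpace ℝ κ}
    (ha : ∀ n, Continuous fun p => a p n) (hb : ∀ n, Continuous fun p => b p n) :
    Continuous fun p => sampleOuter (a p) (b p) := by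
  have h : ∀ n, Continuous fun p => Matrix.vecMulVec (a p n).ofLp (b p n).ofLp := fun n =>
    Continuous.matrix_vecMulVec ((PiLp.continuous_ofLp 2 _).comp (ha n))
      ((PiLp.continuous_ofLp 2 _).comp (hb n))
  exact Continuous.const_smul (g := fun p => ∑ n, Matrix.vecMulVec (a p n).ofLp (b p n).ofLp)
    (continuous_finsetSum _ fun n _ => h n) ((N : ℝ) - 1)⁻¹

theorem continuous_sampleMean {E T : Type} [TopologicalSpace T] [AddCommGroup E] [Module ℝ E]
    [TopologicalSpace E] [ContinuousAdd E] [ContinuousConstSMul ℝ E] {N : ℕ} {X : T → Fin N → E}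
    (hX : ∀ n, Continuous fun p => X p n) : Continuous fun p => sampleMean (X p) :=
  Continuous.const_smul (continuous_finsetSum _ fun n _ => hX n) _

theorem continuousAt_matrix_mul {T : Type*} [TopologicalSpace T] [Fintype κ]
    {A : T → Matrix ι κ ℝ} {B : T → Matrix κ ι' ℝ} {p : T} (hA : ContinuousAt A p)
    (hB : ContinuousAt B p) : ContinuousAt (fun p => A p * B p) p :=
  ContinuousAt.comp (f := fun p => (A p, B p))
    (continuous_fst.matrix_mul continuous_snd).continuousAt (hA.prodMk hB)

theorem continuousAt_toEuclideanLin {T : Type*} [TopologicalSpace T] [Fintype ι] [Fintype κ]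
    [DecidableEq ι] {A : T → Matrix κ ι ℝ} {v : T → EuclideanSpace ℝ ι}
    {p : T} (hA : ContinuousAt A p) (hv : ContinuousAt v p) :
    ContinuousAt (fun p => Matrix.toEuclideanLin (A p) (v p)) p := by
  have h : Continuous fun q : Matrix κ ι ℝ × EuclideanSpace ℝ ι =>
      Matrix.toEuclideanLin q.1 q.2 := by
    simp only [Matrix.toLpLin_apply]
    refine (PiLp.continuous_toLp 2 _).comp (Continuous.matrix_mulVec continuous_fst ?_)
    exact (PiLp.continuous_ofLp 2 _).comp continuous_snd
  exact ContinuousAt.comp (f := fun p => (A p, v p)) h.continuousAt (hA.prodMk hv)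

end Matrices

/-! ### Augmented observations, and the algorithm extended to `τ = 0`. -/

namespace Problem

variable {k m : ℕ} {d : Fin k → ℕ}

theorem contDiff_augObsOp (D : Problem k m d) (hobs : ∀ i, ContDiff ℝ 1 (D.obsOp i)) (i : Fin k) :
    ContDiff ℝ 1 (D.augObsOp i) := by
  refine contDiff_euclidean.2 fun r => ?_
  rcases r with r | r
  · exact contDiff_euclidean.1 (hobs i) r
  · exact contDiff_euclidean.1 contDiff_id r

theorem fderiv_augObsOp (D : Problem k m d) (hobs : ∀ i, ContDiff ℝ 1 (D.obsOp i)) (i : Fin k)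
    (x v : State m) :
    fderiv ℝ (D.augObsOp i) x v = stack (fderiv ℝ (D.obsOp i) x v) v := by
  have h := ((D.contDiff_augObsOp hobs i).differentiable one_ne_zero x).hasFDerivAt
  have hp : ∀ r, HasFDerivAt (fun y => D.augObsOp i y r)
      ((EuclideanSpace.proj r).comp (fderiv ℝ (D.augObsOp i) x)) x := fun r =>
    (EuclideanSpace.proj (𝕜 := ℝ) r).hasFDerivAt.comp x h
  ext r
  rcases r with r | r
  · have h2 : HasFDerivAt (fun y => D.obsOp i y r)
        ((EuclideanSpace.proj r).comp (fderiv ℝ (D.obsOp i) x)) x :=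
      (EuclideanSpace.proj (𝕜 := ℝ) r).hasFDerivAt.comp x
        ((hobs i).differentiable one_ne_zero x).hasFDerivAt
    exact DFunLike.congr_fun ((hp (Sum.inl r)).unique h2) v
  · have h2 : HasFDerivAt (fun y : State m => y r) (EuclideanSpace.proj (𝕜 := ℝ) r) x :=
      (EuclideanSpace.proj (𝕜 := ℝ) (ι := Fin m) r).hasFDerivAt
    exact DFunLike.congr_fun ((hp (Sum.inr r)).unique h2) v

open Matrix in
theorem augR_posDef (D : Problem k m d) (hR : ∀ i, (D.R i).PosDef) (hγ : 0 < D.γ) (i : Fin k) :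
    (D.augR i).PosDef := by
  refine Matrix.PosDef.of_dotProduct_mulVec_pos ?_ fun x hx => ?_
  · rw [Matrix.IsHermitian, augR, Matrix.fromBlocks_conjTranspose, (hR i).1.eq]
    simp
  · have hq : star x ⬝ᵥ (D.augR i).mulVec x = star (x ∘ Sum.inl) ⬝ᵥ (D.R i).mulVec (x ∘ Sum.inl)
        + D.γ⁻¹ * (star (x ∘ Sum.inr) ⬝ᵥ (x ∘ Sum.inr)) := by
      simp [augR, Matrix.fromBlocks_mulVec, dotProduct, Fintype.sum_sum_type, Finset.mul_sum,
        Matrix.smul_mulVec]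
      exact Finset.sum_congr rfl fun _ _ => by ring
    rw [hq]
    by_cases h1 : x ∘ Sum.inl = 0
    · have h2 : x ∘ Sum.inr ≠ 0 := fun h2 => hx <| funext <| by
        rintro (r | r)
        · exact congrFun h1 r
        · exact congrFun h2 r
      have h3 := Matrix.dotProduct_star_self_pos_iff.2 h2
      rw [h1, dotProduct_comm (star _)]
      simpa using mul_pos (inv_pos.2 hγ) h3
    · have h2 := (hR i).dotProduct_mulVec_pos h1
      have h3 : 0 ≤ star (x ∘ Sum.inr) ⬝ᵥ (x ∘ Sum.inr) := by
        simpa [dotProduct] using Finset.sum_nonneg fun r _ => mul_self_nonneg (x (Sum.inr r))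
      have := mul_nonneg (inv_pos.2 hγ).le h3
      linarith

theorem inv_augR (D : Problem k m d) (hR : ∀ i, (D.R i).PosDef) (hγ : 0 < D.γ) (i : Fin k) :
    (D.augR i)⁻¹ = Matrix.fromBlocks (D.R i)⁻¹ 0 0 (D.γ • (1 : Matrix (Fin m) (Fin m) ℝ)) := by
  refine Matrix.inv_eq_right_inv ?_
  have h : IsUnit (D.R i).det := (hR i).det_pos.ne'.isUnit
  simp [augR, Matrix.fromBlocks_multiply, Matrix.mul_nonsing_inv _ h, smul_smul,
    mul_inv_cancel₀ hγ.ne']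

/-- Continuous extension of `forecast` to `τ = 0`. -/
def forecastX (D : Problem k m d) (τ : ℝ) (z : Trajectory k m) (i : Fin k) (v x : State m) :
    State m :=
  fdx τ (D.model i) (z i.castSucc) (x - z i.castSucc) + D.model i (z i.castSucc) + D.μ i + v

/-- Continuous extension of `analysis` to `τ = 0`. -/
def analysisX (D : Problem k m d) (τ : ℝ) (z : Trajectory k m) (i : Fin k) {N : ℕ}
    (w : Fin N → AugObs (d i) m) (X : Fin N → Fin ((i : ℕ) + 2) → State m) :
    Fin N → Fin ((i : ℕ) + 2) → State m :=
  let last := Fin.last ((i : ℕ) + 1)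
  let zi : State m := z i.succ
  let h : Fin N → AugObs (d i) m := fun n =>
    fdx τ (D.augObsOp i) zi (X n last - sampleMean X last)
  let PHt : Fin ((i : ℕ) + 2) → Matrix (Fin m) (Fin (d i) ⊕ Fin m) ℝ := fun l =>
    sampleOuter (fun n => X n l - sampleMean X l) h
  let HPHt : Matrix (Fin (d i) ⊕ Fin m) (Fin (d i) ⊕ Fin m) ℝ := sampleOuter h h
  fun n l => X n l + Matrix.toEuclideanLin (PHt l * (HPHt + D.augR i)⁻¹)
    (stack (D.y i) zi - w n - D.augObsOp i zi - fdx τ (D.augObsOp i) zi (X n last - zi))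

/-- Continuous extension of `ensemble` to `τ = 0`. -/
def ensembleX (D : Problem k m d) (τ : ℝ) (z : Trajectory k m) (N : ℕ)
    (e : ℕ → (c : Source k) → Noise m d c) :
    (i : ℕ) → i ≤ k → Fin N → Fin (i + 1) → State m
  | 0, _ => fun n _ => e n Source.init
  | i + 1, hi =>
    let X := ensembleX D τ z N e i (Nat.le_of_succ_le hi)
    let t : Fin k := ⟨i, hi⟩
    D.analysisX τ z t (fun n => e n (Source.obs t))
      (fun n => Fin.snoc (α := fun _ => State m) (X n)
        (D.forecastX τ z t (e n (Source.model t)) (X n (Fin.last i))))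

/-- Continuous extension of `iterate` to `τ = 0`. -/
def iterateX (D : Problem k m d) (τ : ℝ) (N : ℕ → ℕ) (x0 : Trajectory k m)
    (e : ℕ → ℕ → (c : Source k) → Noise m d c) : ℕ → Trajectory k m
  | 0 => x0
  | j + 1 => WithLp.toLp 2 (sampleMean
      (D.ensembleX τ (D.iterateX τ N x0 e j) (N (j + 1)) (e (j + 1)) k le_rfl))

theorem ensembleX_of_ne (D : Problem k m d) {τ : ℝ} (hτ : τ ≠ 0) (z : Trajectory k m) (N : ℕ)
    (e : ℕ → (c : Source k) → Noise m d c) (i : ℕ) (hi : i ≤ k) :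
    D.ensembleX τ z N e i hi = D.ensemble τ z N e i hi := by
  induction i with
  | zero => rfl
  | succ i ih =>
    simp only [ensembleX, ensemble, ih (Nat.le_of_succ_le hi), analysisX, analysis, forecastX,
      forecast, fdx_of_ne hτ]

theorem iterateX_of_ne (D : Problem k m d) {τ : ℝ} (hτ : τ ≠ 0) (N : ℕ → ℕ) (x0 : Trajectory k m)
    (e : ℕ → ℕ → (c : Source k) → Noise m d c) (j : ℕ) :
    D.iterateX τ N x0 e j = D.iterate τ N x0 e j := by
  induction j with
  | zero => rfl
  | succ j ih => simp only [iterateX, iterate, ih, D.ensembleX_of_ne hτ]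

/-! ### Continuity of the algorithm in the step and the perturbations. -/

section Continuity

variable {T : Type} [TopologicalSpace T] (D : Problem k m d)
  (hR : ∀ i, (D.R i).PosDef) (hγ : 0 < D.γ)
  (hmodel : ∀ i, ContDiff ℝ 1 (D.model i)) (hobs : ∀ i, ContDiff ℝ 1 (D.obsOp i))
  {τ : T → ℝ} {z : T → Trajectory k m} (hτ : Continuous τ) (hz : ∀ l, Continuous fun p => z p l)

include hmodel hτ hz in
theorem continuous_forecastX (i : Fin k) {v x : T → State m} (hv : Continuous v)
    (hx : Continuous x) : Continuous fun p => D.forecastX (τ p) (z p) i (v p) (x p) := by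
  have h1 := continuous_fdx (hmodel i) hτ (hz i.castSucc) (hx.sub (hz i.castSucc))
  have h2 := (hmodel i).continuous.comp (hz i.castSucc)
  exact ((h1.add h2).add continuous_const).add hv

theorem _root_.EnKS.continuous_stack {a b : ℕ} {v : T → EuclideanSpace ℝ (Fin a)} {w : T → State b}
    (hv : Continuous v) (hw : Continuous w) : Continuous fun p => stack (v p) (w p) := by
  refine (PiLp.continuous_toLp 2 _).comp (continuous_pi fun r => ?_)
  rcases r with r | r
  · exact (EuclideanSpace.proj r).continuous.comp hv
  · exact (EuclideanSpace.proj r).continuous.comp hw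

include hR hγ hobs hτ hz in
-- The inverse in the gain causes no singularity: `HPHt` is positive semidefinite for every
-- ensemble, and adding `augR` makes it positive definite.
theorem continuous_analysisX (i : Fin k) {N : ℕ} {w : T → Fin N → AugObs (d i) m}
    {X : T → Fin N → Fin ((i : ℕ) + 2) → State m} (hw : ∀ n, Continuous fun p => w p n)
    (hX : ∀ n l, Continuous fun p => X p n l) (n : Fin N) (l : Fin ((i : ℕ) + 2)) :
    Continuous fun p => D.analysisX (τ p) (z p) i (w p) (X p) n l := by
  have hmean : ∀ l, Continuous fun p => sampleMean (X p) l := fun l => by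
    have h : Continuous fun p => sampleMean (X p) :=
      continuous_sampleMean fun n => continuous_pi fun l => hX n l
    exact (continuous_apply l).comp h
  have hA := D.contDiff_augObsOp hobs i
  have hh : ∀ n, Continuous fun p => fdx (τ p) (D.augObsOp i) (z p i.succ)
      (X p n (Fin.last _) - sampleMean (X p) (Fin.last _)) := fun n =>
    continuous_fdx hA hτ (hz _) ((hX n _).sub (hmean _))
  have hS := continuous_sampleOuter hh hh
  have hP := continuous_sampleOuter (fun n => (hX n l).sub (hmean l)) hh
  rw [continuous_iff_continuousAt]
  intro p
  refine (hX n l).continuousAt.add (continuousAt_toEuclideanLin ?_ ?_)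
  · refine continuousAt_matrix_mul hP.continuousAt (continuousAt_matrix_inv ?_ ?_)
    · exact (hS.add continuous_const).continuousAt
    · exact (Matrix.PosDef.posSemidef_add (sampleOuter_posSemidef _) (D.augR_posDef hR hγ i))
  · refine Continuous.continuousAt ?_
    exact (((continuous_stack continuous_const (hz _)).sub (hw n)).sub
      (hA.continuous.comp (hz _))).sub (continuous_fdx hA hτ (hz _) ((hX n _).sub (hz _)))

include hR hγ hmodel hobs hτ hz in
theorem continuous_ensembleX {N : ℕ} {e : T → ℕ → (c : Source k) → Noise m d c}
    (he : ∀ n c, Continuous fun p => e p n c) (i : ℕ) (hi : i ≤ k) (n : Fin N) (l : Fin (i + 1)) :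
    Continuous fun p => D.ensembleX (τ p) (z p) N (e p) i hi n l := by
  induction i generalizing n with
  | zero => exact he _ _
  | succ i ih =>
    have ih' := ih (Nat.le_of_succ_le hi)
    have hX : ∀ n l, Continuous fun p => Fin.snoc (α := fun _ => State m)
        (D.ensembleX (τ p) (z p) N (e p) i (Nat.le_of_succ_le hi) n)
        (D.forecastX (τ p) (z p) ⟨i, hi⟩ (e p n (Source.model ⟨i, hi⟩))
          (D.ensembleX (τ p) (z p) N (e p) i (Nat.le_of_succ_le hi) n (Fin.last i))) l := by
      intro n l
      refine Fin.lastCases ?_ (fun l => ?_) l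
      · simp only [Fin.snoc_last]
        exact D.continuous_forecastX hmodel hτ hz _ (he _ _) (ih' n _)
      · simp only [Fin.snoc_castSucc]
        exact ih' n l
    exact D.continuous_analysisX (w := fun p n => e p n (Source.obs ⟨i, hi⟩)) hR hγ hobs hτ hz ⟨i, hi⟩ (fun n => he n _) hX n l

include hR hγ hmodel hobs hτ in
theorem continuous_iterateX {e : T → ℕ → ℕ → (c : Source k) → Noise m d c}
    (he : ∀ j n c, Continuous fun p => e p j n c) (N : ℕ → ℕ) (x0 : Trajectory k m) (j : ℕ) :
    Continuous fun p => D.iterateX (τ p) N x0 (e p) j := by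
  induction j with
  | zero => exact continuous_const
  | succ j ih =>
    refine (PiLp.continuous_toLp 2 _).comp (continuous_sampleMean fun n => continuous_pi fun l => ?_)
    exact D.continuous_ensembleX hR hγ hmodel hobs hτ
      (fun l => (PiLp.proj 2 (𝕜 := ℝ) (fun _ => State m) l).continuous.comp ih) (he (j + 1)) k le_rfl n l

end Continuity

end Problem

/-! ### All perturbations of one member as a single vector. -/

/-- The kinds of perturbations, listed. -/
def Source.equivSum (k : ℕ) : Source k ≃ Unit ⊕ (Fin k ⊕ Fin k) where
  toFun
    | .init => .inl ()
    | .model i => .inr (.inl i)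
    | .obs i => .inr (.inr i)
  invFun
    | .inl _ => .init
    | .inr (.inl i) => .model i
    | .inr (.inr i) => .obs i
  left_inv c := by cases c <;> rfl
  right_inv c := by rcases c with c | c | c <;> rfl

instance (k : ℕ) : Fintype (Source k) := Fintype.ofEquiv _ (Source.equivSum k).symm

instance (k : ℕ) : DecidableEq (Source k) := (Source.equivSum k).decidableEq

theorem Source.sum_eq {k : ℕ} {M : Type*} [AddCommMonoid M] (f : Source k → M) :
    ∑ c, f c = f .init + ∑ i, f (.model i) + ∑ i, f (.obs i) := by
  rw [← (Source.equivSum k).symm.sum_comp f, Fintype.sum_sum_type, Fintype.sum_sum_type, add_assoc]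
  simp [Source.equivSum]

instance Source.fintypeCoord {k m : ℕ} {d : Fin k → ℕ} : (c : Source k) → Fintype (c.Coord m d)
  | .init => inferInstanceAs (Fintype (Fin m))
  | .model _ => inferInstanceAs (Fintype (Fin m))
  | .obs i => inferInstanceAs (Fintype (Fin (d i) ⊕ Fin m))

instance Source.decidableEqCoord {k m : ℕ} {d : Fin k → ℕ} :
    (c : Source k) → DecidableEq (c.Coord m d)
  | .init => inferInstanceAs (DecidableEq (Fin m))
  | .model _ => inferInstanceAs (DecidableEq (Fin m))
  | .obs i => inferInstanceAs (DecidableEq (Fin (d i) ⊕ Fin m))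

/-- The coordinates of all perturbations of one ensemble member. -/
abbrev Idx {k : ℕ} (m : ℕ) (d : Fin k → ℕ) : Type := (c : Source k) × c.Coord m d

variable {k m : ℕ} {d : Fin k → ℕ}

/-- All perturbations of one member as one vector. -/
def flat (u : (c : Source k) → Noise m d c) : EuclideanSpace ℝ (Idx m d) :=
  WithLp.toLp 2 fun p => u p.1 p.2

/-- The matrix of the projection to the perturbation of kind `c`. -/
def select (m : ℕ) (d : Fin k → ℕ) (c : Source k) : Matrix (c.Coord m d) (Idx m d) ℝ :=
  (1 : Matrix (Idx m d) (Idx m d) ℝ).submatrix (Sigma.mk c) id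

theorem select_mulVec (c : Source k) (u : Idx m d → ℝ) :
    (select m d c).mulVec u = fun a => u ⟨c, a⟩ := by
  ext a
  simp [select, Matrix.mulVec, dotProduct, Matrix.one_apply]

theorem select_flat (c : Source k) (u : (c : Source k) → Noise m d c) :
    Matrix.toEuclideanLin (select m d c) (flat u) = u c := by
  rw [Matrix.toLpLin_apply, select_mulVec]
  rfl

/-- The Jacobian matrix. -/
def jac {ι κ : Type} [Fintype ι] [Fintype κ] [DecidableEq ι]
    (f : EuclideanSpace ℝ ι → EuclideanSpace ℝ κ) (x : EuclideanSpace ℝ ι) : Matrix κ ι ℝ :=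
  Matrix.toEuclideanLin.symm (fderiv ℝ f x : EuclideanSpace ℝ ι →ₗ[ℝ] EuclideanSpace ℝ κ)

theorem toEuclideanLin_jac {ι κ : Type} [Fintype ι] [Fintype κ] [DecidableEq ι]
    (f : EuclideanSpace ℝ ι → EuclideanSpace ℝ κ) (x v : EuclideanSpace ℝ ι) :
    Matrix.toEuclideanLin (jac f x) v = fderiv ℝ f x v := by
  simp [jac]

theorem continuous_jac {ι κ : Type} [Fintype ι] [Fintype κ] [DecidableEq ι]
    {f : EuclideanSpace ℝ ι → EuclideanSpace ℝ κ} (hf : ContDiff ℝ 1 f) : Continuous (jac f) := by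
  have hc : Continuous (fderiv ℝ f) := hf.continuous_fderiv one_ne_zero
  refine continuous_matrix fun a b => ?_
  have h : ∀ x, jac f x a b = fderiv ℝ f x (EuclideanSpace.single b 1) a := fun x => by
    rw [← toEuclideanLin_jac, Matrix.toLpLin_apply]
    simp
  simp only [h]
  exact (EuclideanSpace.proj a).continuous.comp (hc.clm_apply continuous_const)

namespace Problem

variable (D : Problem k m d)

/-! ### The Kalman smoother -/

/-- Forecast of the coefficient matrices (with respect to the perturbations) of the states. -/
def forecastCoef (z : Trajectory k m) (t : Fin k) (A : ℕ → Matrix (Fin m) (Idx m d) ℝ) :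
    ℕ → Matrix (Fin m) (Idx m d) ℝ :=
  Function.update A (t + 1) (jac (D.model t) (z t.castSucc) * A t + select m d (.model t))

/-- The coefficient matrix of the predicted observation. -/
def obsCoef (z : Trajectory k m) (t : Fin k) (A : ℕ → Matrix (Fin m) (Idx m d) ℝ) :
    Matrix (Fin (d t) ⊕ Fin m) (Idx m d) ℝ :=
  jac (D.augObsOp t) (z t.succ) * A (t + 1)

/-- The Kalman gain, if `C` is the covariance of the perturbations. -/
def gain (C : Matrix (Idx m d) (Idx m d) ℝ) (z : Trajectory k m) (t : Fin k)
    (A : ℕ → Matrix (Fin m) (Idx m d) ℝ) (l : ℕ) : Matrix (Fin m) (Fin (d t) ⊕ Fin m) ℝ :=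
  A l * C * (D.obsCoef z t A).transpose *
    (D.obsCoef z t A * C * (D.obsCoef z t A).transpose + D.augR t)⁻¹

/-- The coefficient matrices of the states after the analysis at time `i`. -/
def coef (C : Matrix (Idx m d) (Idx m d) ℝ) (z : Trajectory k m) :
    (i : ℕ) → i ≤ k → ℕ → Matrix (Fin m) (Idx m d) ℝ
  | 0, _ => fun _ => select m d .init
  | i + 1, hi =>
    let t : Fin k := ⟨i, hi⟩
    let A := D.forecastCoef z t (coef C z i (Nat.le_of_succ_le hi))
    fun l => A l - D.gain C z t A l * (D.obsCoef z t A + select m d (.obs t))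

/-- Forecast of the means of the states. -/
def forecastMean (u : EuclideanSpace ℝ (Idx m d)) (z : Trajectory k m) (t : Fin k)
    (a : ℕ → State m) : ℕ → State m :=
  Function.update a (t + 1) (fderiv ℝ (D.model t) (z t.castSucc) (a t - z t.castSucc)
    + D.model t (z t.castSucc) + D.μ t + Matrix.toEuclideanLin (select m d (.model t)) u)

/-- The innovation in the mean. -/
def innovation (u : EuclideanSpace ℝ (Idx m d)) (z : Trajectory k m) (t : Fin k)
    (a : ℕ → State m) : AugObs (d t) m :=
  stack (D.y t) (z t.succ) - Matrix.toEuclideanLin (select m d (.obs t)) u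
    - D.augObsOp t (z t.succ) - fderiv ℝ (D.augObsOp t) (z t.succ) (a (t + 1) - z t.succ)

/-- The means of the states after the analysis at time `i`, if `u` is the mean and `C` the
covariance of the perturbations. -/
def mean (u : EuclideanSpace ℝ (Idx m d)) (C : Matrix (Idx m d) (Idx m d) ℝ)
    (z : Trajectory k m) : (i : ℕ) → i ≤ k → ℕ → State m
  | 0, _ => fun _ => Matrix.toEuclideanLin (select m d .init) u
  | i + 1, hi =>
    let t : Fin k := ⟨i, hi⟩
    let A := D.forecastCoef z t (D.coef C z i (Nat.le_of_succ_le hi))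
    let a := D.forecastMean u z t (mean u C z i (Nat.le_of_succ_le hi))
    fun l => a l + Matrix.toEuclideanLin (D.gain C z t A l) (D.innovation u z t a)

theorem _root_.EnKS.sampleMean_affine {ι κ : Type} [Fintype κ] [DecidableEq κ] {N : ℕ} (hN : N ≠ 0)
    (a : EuclideanSpace ℝ ι) (A : Matrix ι κ ℝ) (U : Fin N → EuclideanSpace ℝ κ) :
    sampleMean (fun n => a + Matrix.toEuclideanLin A (U n - sampleMean U)) = a := by
  have hN' : (N : ℝ) ≠ 0 := Nat.cast_ne_zero.2 hN
  have h : ∑ n, (U n - sampleMean U) = 0 := by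
    simp [sampleMean, ← Nat.cast_smul_eq_nsmul ℝ, smul_smul, mul_inv_cancel₀ hN']
  rw [sampleMean, Finset.sum_add_distrib, ← map_sum, h]
  simp [← Nat.cast_smul_eq_nsmul ℝ, smul_smul, inv_mul_cancel₀ hN']

/-- At `τ = 0`, the members of the ensemble are images of their perturbations under an affine map
that depends only on the sample mean and covariance of the perturbations. -/
theorem ensembleX_zero_eq (z : Trajectory k m) {N : ℕ} (hN : N ≠ 0)
    (e : ℕ → (c : Source k) → Noise m d c) {U : Fin N → EuclideanSpace ℝ (Idx m d)}
    (hU : ∀ n : Fin N, U n = flat (e n)) {C : Matrix (Idx m d) (Idx m d) ℝ}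
    (hC : C = sampleOuter (fun n => U n - sampleMean U) (fun n => U n - sampleMean U))
    (i : ℕ) (hi : i ≤ k) (n : Fin N) (l : Fin (i + 1)) :
    D.ensembleX 0 z N e i hi n l = D.mean (sampleMean U) C z i hi l
      + Matrix.toEuclideanLin (D.coef C z i hi l) (U n - sampleMean U) := by
  induction i generalizing n with
  | zero =>
    simp only [ensembleX, mean, coef]
    rw [← map_add, add_sub_cancel, hU]
    exact (select_flat _ _).symm
  | succ i ih =>
    have ih' := ih (Nat.le_of_succ_le hi)
    set t : Fin k := ⟨i, hi⟩ with ht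
    set A := D.forecastCoef z t (D.coef C z i (Nat.le_of_succ_le hi)) with hA
    set a := D.forecastMean (sampleMean U) z t (D.mean (sampleMean U) C z i
      (Nat.le_of_succ_le hi)) with ha
    set Δ : Fin N → EuclideanSpace ℝ (Idx m d) := fun n => U n - sampleMean U with hΔ
    set X : Fin N → Fin (i + 2) → State m := fun n => Fin.snoc (α := fun _ => State m)
      (D.ensembleX 0 z N e i (Nat.le_of_succ_le hi) n)
      (D.forecastX 0 z t (e n (Source.model t))
        (D.ensembleX 0 z N e i (Nat.le_of_succ_le hi) n (Fin.last i))) with hX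
    -- The forecast keeps the affine form: only the state of time `i + 1` is new, and its model
    -- error is a coordinate block of `U n`.
    have hX' : ∀ n l, X n l = a l + Matrix.toEuclideanLin (A l) (Δ n) := by
      intro n l
      refine Fin.lastCases ?_ (fun l => ?_) l
      · have h1 : e n (.model t) = Matrix.toEuclideanLin (select m d (.model t)) (sampleMean U)
            + Matrix.toEuclideanLin (select m d (.model t)) (Δ n) := by
          rw [← map_add, hΔ, add_sub_cancel, hU, select_flat]
        simp only [hX, Fin.snoc_last, ih', hA, ha, forecastX, fdx_zero, forecastCoef, forecastMean,
          Fin.val_last, ht, Function.update_self, map_add, LinearMap.add_apply, toEuclideanLin_mul,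
          toEuclideanLin_jac, map_sub]
        rw [h1]
        simp only [hΔ, map_sub]
        abel
      · have h2 : (l : ℕ) ≠ i + 1 := l.isLt.ne
        simp [hX, ih', hA, ha, forecastCoef, forecastMean, ht, h2, hΔ]
    have hmean : ∀ l : Fin (i + 2), sampleMean X l = a l := by
      intro l
      have h3 : sampleMean X l = sampleMean fun n => X n l := by
        simp [sampleMean]
      rw [h3]
      simp only [hX', hΔ]
      exact sampleMean_affine hN _ _ _
    have hdev : ∀ n l, X n l - sampleMean X l = Matrix.toEuclideanLin (A l) (Δ n) := by
      intro n l
      rw [hmean, hX', add_sub_cancel_left]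
    have hlast : ∀ n, fderiv ℝ (D.augObsOp t) (z t.succ) (Matrix.toEuclideanLin (A (i + 1)) (Δ n))
        = Matrix.toEuclideanLin (D.obsCoef z t A) (Δ n) := by
      intro n
      rw [obsCoef, toEuclideanLin_mul, toEuclideanLin_jac]
    have hw : e n (.obs t) = Matrix.toEuclideanLin (select m d (.obs t)) (sampleMean U)
        + Matrix.toEuclideanLin (select m d (.obs t)) (Δ n) := by
      rw [← map_add, hΔ, add_sub_cancel, hU, select_flat]
    have hE : D.ensembleX 0 z N e (i + 1) hi n l
        = D.analysisX 0 z t (fun n => e n (Source.obs t)) X n l := rfl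
    -- The innovation of a member is affine in its deviation `Δ n`, with linear part minus `obsCoef
    -- + select`.
    have hinn : stack (D.y t) (z t.succ) - e n (.obs t) - D.augObsOp t (z t.succ)
        - fderiv ℝ (D.augObsOp t) (z t.succ) (X n (Fin.last (i + 1)) - z t.succ)
        = D.innovation (sampleMean U) z t a
          - Matrix.toEuclideanLin (D.obsCoef z t A + select m d (.obs t)) (Δ n) := by
      have h4 : X n (Fin.last (i + 1)) - z t.succ
          = (a (i + 1) - z t.succ) + Matrix.toEuclideanLin (A (i + 1)) (Δ n) := by
        rw [hX', Fin.val_last]; abel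
      rw [h4, map_add, hlast, hw, innovation]
      simp only [map_add, LinearMap.add_apply]
      rw [show (t : ℕ) = i from rfl]
      abel
    -- Sample covariances of linear images are `A C Bᵀ`, so the ensemble gain is the Kalman gain for
    -- the sample covariance `C`.
    have hgain : sampleOuter (fun n => Matrix.toEuclideanLin (A l) (Δ n))
          (fun n => Matrix.toEuclideanLin (D.obsCoef z t A) (Δ n))
        * (sampleOuter (fun n => Matrix.toEuclideanLin (D.obsCoef z t A) (Δ n))
          (fun n => Matrix.toEuclideanLin (D.obsCoef z t A) (Δ n)) + D.augR t)⁻¹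
        = D.gain C z t A l := by
      rw [sampleOuter_toEuclideanLin, sampleOuter_toEuclideanLin, gain, hC]
    rw [hE]
    simp only [analysisX, fdx_zero, hdev, Fin.val_last]
    simp only [show ∀ n, fderiv ℝ (D.augObsOp t) (z t.succ)
      (Matrix.toEuclideanLin (A ((t : ℕ) + 1)) (Δ n))
        = Matrix.toEuclideanLin (D.obsCoef z t A) (Δ n) from hlast]
    erw [hgain, hinn]
    have hcoef : Matrix.toEuclideanLin (D.coef C z (i + 1) hi l) (Δ n)
        = Matrix.toEuclideanLin (A l) (Δ n) - Matrix.toEuclideanLin (D.gain C z t A l)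
          (Matrix.toEuclideanLin (D.obsCoef z t A + select m d (.obs t)) (Δ n)) := by
      rw [← toEuclideanLin_mul, ← LinearMap.sub_apply, ← map_sub]
      rfl
    have hmean' : D.mean (sampleMean U) C z (i + 1) hi l
        = a l + Matrix.toEuclideanLin (D.gain C z t A l) (D.innovation (sampleMean U) z t a) := rfl
    rw [hX', map_sub (Matrix.toEuclideanLin (D.gain C z t A l)), hmean']
    exact (eq_add_of_sub_eq' (by rw [hcoef]; abel))

/-- Deviations from the sample mean sum to zero, so averaging the affine representation of the
members leaves only `mean`. -/
theorem iterateX_zero_succ (N : ℕ → ℕ) (x0 : Trajectory k m)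
    (e : ℕ → ℕ → (c : Source k) → Noise m d c) (j : ℕ) (hN : N (j + 1) ≠ 0)
    {U : Fin (N (j + 1)) → EuclideanSpace ℝ (Idx m d)} (hU : ∀ n, U n = flat (e (j + 1) n)) :
    D.iterateX 0 N x0 e (j + 1) = WithLp.toLp 2 fun l : Fin (k + 1) =>
      D.mean (sampleMean U)
        (sampleOuter (fun n => U n - sampleMean U) (fun n => U n - sampleMean U))
        (D.iterateX 0 N x0 e j) k le_rfl l := by
  rw [iterateX]
  congr 1
  funext l
  have h := fun n => D.ensembleX_zero_eq (D.iterateX 0 N x0 e j) hN (e (j + 1)) hU rfl k le_rfl n l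
  have h3 : sampleMean (D.ensembleX 0 (D.iterateX 0 N x0 e j) (N (j + 1)) (e (j + 1)) k le_rfl) l
      = sampleMean fun n => D.ensembleX 0 (D.iterateX 0 N x0 e j) (N (j + 1)) (e (j + 1)) k le_rfl
        n l := by
    simp [sampleMean]
  rw [h3]
  simp only [h]
  exact sampleMean_affine hN _ _ _

/-! ### Continuity of the smoother in the moments and the linearization point. -/

section Continuity

variable {T : Type*} [TopologicalSpace T]
  (hR : ∀ i, (D.R i).PosDef) (hγ : 0 < D.γ)
  (hmodel : ∀ i, ContDiff ℝ 1 (D.model i)) (hobs : ∀ i, ContDiff ℝ 1 (D.obsOp i))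
  {u : T → EuclideanSpace ℝ (Idx m d)} {C : T → Matrix (Idx m d) (Idx m d) ℝ}
  {z : T → Trajectory k m} {p : T} (hu : ContinuousAt u p) (hC : ContinuousAt C p)
  (hCp : (C p).PosSemidef) (hz : ContinuousAt z p)

include hmodel hz in
theorem continuousAt_forecastCoef (t : Fin k) {A : T → ℕ → Matrix (Fin m) (Idx m d) ℝ}
    (hA : ∀ l, ContinuousAt (fun q => A q l) p) (l : ℕ) :
    ContinuousAt (fun q => D.forecastCoef (z q) t (A q) l) p := by
  have hz' : ContinuousAt (fun q => z q t.castSucc) p :=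
    (PiLp.proj 2 (𝕜 := ℝ) (fun _ => State m) t.castSucc).continuous.continuousAt.comp hz
  unfold forecastCoef
  by_cases hl : l = t + 1
  · subst hl
    simp only [Function.update_self]
    exact (continuousAt_matrix_mul
      (ContinuousAt.comp (f := fun q => z q t.castSucc)
        (continuous_jac (hmodel t)).continuousAt hz') (hA t)).add continuousAt_const
  · simpa only [Function.update_of_ne hl] using hA l

include hobs hz in
theorem continuousAt_obsCoef (t : Fin k) {A : T → ℕ → Matrix (Fin m) (Idx m d) ℝ}
    (hA : ∀ l, ContinuousAt (fun q => A q l) p) :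
    ContinuousAt (fun q => D.obsCoef (z q) t (A q)) p := by
  have hz' : ContinuousAt (fun q => z q t.succ) p :=
    (PiLp.proj 2 (𝕜 := ℝ) (fun _ => State m) t.succ).continuous.continuousAt.comp hz
  exact continuousAt_matrix_mul
    (ContinuousAt.comp (f := fun q => z q t.succ)
      (continuous_jac (D.contDiff_augObsOp hobs t)).continuousAt hz') (hA _)

include hR hγ in
theorem gain_posDef {C : Matrix (Idx m d) (Idx m d) ℝ} (hC : C.PosSemidef) (z : Trajectory k m)
    (t : Fin k) (A : ℕ → Matrix (Fin m) (Idx m d) ℝ) :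
    (D.obsCoef z t A * C * (D.obsCoef z t A).transpose + D.augR t).PosDef :=
  Matrix.PosDef.posSemidef_add (hC.mul_mul_conjTranspose_same _) (D.augR_posDef hR hγ t)

include hR hγ hobs hC hCp hz in
theorem continuousAt_gain (t : Fin k) {A : T → ℕ → Matrix (Fin m) (Idx m d) ℝ}
    (hA : ∀ l, ContinuousAt (fun q => A q l) p) (l : ℕ) :
    ContinuousAt (fun q => D.gain (C q) (z q) t (A q) l) p := by
  have hG := D.continuousAt_obsCoef hobs hz t hA
  have hGt : ContinuousAt (fun q => (D.obsCoef (z q) t (A q)).transpose) p :=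
    ContinuousAt.comp (f := fun q => D.obsCoef (z q) t (A q))
      continuous_id.matrix_transpose.continuousAt hG
  refine continuousAt_matrix_mul
    (continuousAt_matrix_mul (continuousAt_matrix_mul (hA l) hC) hGt)
    (continuousAt_matrix_inv ?_ (D.gain_posDef hR hγ hCp (z p) t (A p)))
  exact (continuousAt_matrix_mul (continuousAt_matrix_mul hG hC) hGt).add continuousAt_const

include hR hγ hmodel hobs hC hCp hz in
theorem continuousAt_coef (i : ℕ) (hi : i ≤ k) (l : ℕ) :
    ContinuousAt (fun q => D.coef (C q) (z q) i hi l) p := by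
  induction i generalizing l with
  | zero => exact continuousAt_const
  | succ i ih =>
    have hA := D.continuousAt_forecastCoef hmodel hz ⟨i, hi⟩ (ih (Nat.le_of_succ_le hi))
    exact (hA l).sub (continuousAt_matrix_mul
      (D.continuousAt_gain hR hγ hobs hC hCp hz _ hA l)
      ((D.continuousAt_obsCoef hobs hz _ hA).add continuousAt_const))

include hR hγ hmodel hobs hu hC hCp hz in
-- Positive semidefiniteness of `C` is required only at the limit point `p`: it makes the matrix
-- inverted in the gain positive definite there, and inversion is continuous at such a matrix.
theorem continuousAt_mean (i : ℕ) (hi : i ≤ k) (l : ℕ) :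
    ContinuousAt (fun q => D.mean (u q) (C q) (z q) i hi l) p := by
  have hz' : ∀ l, ContinuousAt (fun q => z q l) p := fun l =>
    (PiLp.proj 2 (𝕜 := ℝ) (fun _ => State m) l).continuous.continuousAt.comp hz
  induction i generalizing l with
  | zero => exact continuousAt_toEuclideanLin continuousAt_const hu
  | succ i ih =>
    have ih' := ih (Nat.le_of_succ_le hi)
    set t : Fin k := ⟨i, hi⟩
    have hA := D.continuousAt_forecastCoef hmodel hz t
      (D.continuousAt_coef hR hγ hmodel hobs hC hCp hz i (Nat.le_of_succ_le hi))
    have ha : ∀ l, ContinuousAt (fun q => D.forecastMean (u q) (z q) t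
        (D.mean (u q) (C q) (z q) i (Nat.le_of_succ_le hi)) l) p := by
      intro l
      unfold forecastMean
      by_cases hl : l = t + 1
      · subst hl
        simp only [Function.update_self, ← toEuclideanLin_jac]
        refine ContinuousAt.add (ContinuousAt.add (ContinuousAt.add ?_ ?_) continuousAt_const)
          (continuousAt_toEuclideanLin continuousAt_const hu)
        · exact continuousAt_toEuclideanLin (ContinuousAt.comp (f := fun q => z q t.castSucc)
            (continuous_jac (hmodel t)).continuousAt (hz' _)) ((ih' t).sub (hz' _))
        · exact ContinuousAt.comp (f := fun q => z q t.castSucc)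
            (hmodel t).continuous.continuousAt (hz' _)
      · simpa only [Function.update_of_ne hl] using ih' l
    refine (ha l).add (continuousAt_toEuclideanLin
      (D.continuousAt_gain hR hγ hobs hC hCp hz t hA l) ?_)
    unfold innovation
    have hO := D.contDiff_augObsOp hobs t
    simp only [← toEuclideanLin_jac]
    refine ContinuousAt.sub (ContinuousAt.sub (ContinuousAt.sub ?_ ?_) ?_) ?_
    · have hs : Continuous fun b : State m => stack (D.y t) b :=
        continuous_stack continuous_const continuous_id
      exact ContinuousAt.comp (f := fun q => z q t.succ) hs.continuousAt (hz' _)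
    · exact continuousAt_toEuclideanLin continuousAt_const hu
    · exact ContinuousAt.comp (f := fun q => z q t.succ) hO.continuous.continuousAt (hz' _)
    · exact continuousAt_toEuclideanLin (ContinuousAt.comp (f := fun q => z q t.succ)
        (continuous_jac hO).continuousAt (hz' _)) ((ha _).sub (hz' _))

end Continuity

end Problem

/-! ### Trajectories as perturbations, and the tangent equations. -/

namespace Problem

variable (D : Problem k m d)

/-- The perturbations that produce the trajectory `x` in the model linearized at `z` and that
explain the data. -/
def noiseOf (z x : Trajectory k m) : (c : Source k) → Noise m d c
  | .init => x 0
  | .model t => x t.succ - (fderiv ℝ (D.model t) (z t.castSucc) (x t.castSucc - z t.castSucc)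
      + D.model t (z t.castSucc) + D.μ t)
  | .obs t => stack (D.y t) (z t.succ) - D.augObsOp t (z t.succ)
      - fderiv ℝ (D.augObsOp t) (z t.succ) (x t.succ - z t.succ)

/-- The perturbations `noiseOf z x` drive the smoother to the trajectory `x`, for any gain. -/
theorem mean_add_coef_noiseOf (u : EuclideanSpace ℝ (Idx m d)) (C : Matrix (Idx m d) (Idx m d) ℝ)
    (z x : Trajectory k m) (i : ℕ) (hi : i ≤ k) (l : ℕ) (hl : l ≤ i) :
    D.mean u C z i hi l + Matrix.toEuclideanLin (D.coef C z i hi l) (flat (D.noiseOf z x) - u)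
      = x ⟨l, by omega⟩ := by
  induction i generalizing l with
  | zero =>
    obtain rfl : l = 0 := by omega
    simp only [mean, coef]
    rw [← map_add, add_sub_cancel]
    exact select_flat _ _
  | succ i ih =>
    set w := flat (D.noiseOf z x) - u with hw
    set t : Fin k := ⟨i, hi⟩ with ht
    set A := D.forecastCoef z t (D.coef C z i (Nat.le_of_succ_le hi)) with hA
    set a := D.forecastMean u z t (D.mean u C z i (Nat.le_of_succ_le hi)) with ha
    have hsel : ∀ c, Matrix.toEuclideanLin (select m d c) u
        + Matrix.toEuclideanLin (select m d c) w = D.noiseOf z x c := fun c => by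
      rw [← map_add, hw, add_sub_cancel, select_flat]
    have hlast : a (i + 1) + Matrix.toEuclideanLin (A (i + 1)) w = x t.succ := by
      have h1 := ih (Nat.le_of_succ_le hi) i le_rfl
      have h2 := hsel (.model t)
      have h3 : x t.castSucc - z t.castSucc
          = (D.mean u C z i (Nat.le_of_succ_le hi) i - z t.castSucc)
            + Matrix.toEuclideanLin (D.coef C z i (Nat.le_of_succ_le hi) i) w := by
        rw [show x t.castSucc = _ from h1.symm]; abel
      simp only [hA, ha, forecastMean, forecastCoef, ht, Function.update_self, map_add,
        LinearMap.add_apply, toEuclideanLin_mul, toEuclideanLin_jac]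
      simp only [noiseOf] at h2
      rw [h3, map_add] at h2
      rw [← sub_eq_zero] at h2 ⊢
      rw [← h2]
      abel
    have hpre : ∀ l (hl : l ≤ i + 1), a l + Matrix.toEuclideanLin (A l) w = x ⟨l, by omega⟩ := by
      intro l hl
      rcases hl.lt_or_eq with h | rfl
      · have hne : l ≠ i + 1 := h.ne
        simpa [ha, hA, forecastMean, forecastCoef, ht, hne] using
          ih (Nat.le_of_succ_le hi) l (by omega)
      · exact hlast
    -- The perturbations explain the data exactly, so the gain adds to the mean what it subtracts
    -- through the coefficients. This cancellation makes the choice of gain irrelevant.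
    have hinn : D.innovation u z t a
        = Matrix.toEuclideanLin (D.obsCoef z t A + select m d (.obs t)) w := by
      have h2 := hsel (.obs t)
      have h3 : x t.succ - z t.succ = (a (i + 1) - z t.succ)
          + Matrix.toEuclideanLin (A (i + 1)) w := by
        rw [← hlast]; abel
      simp only [noiseOf] at h2
      rw [h3, map_add] at h2
      simp only [innovation, obsCoef, map_add, LinearMap.add_apply, toEuclideanLin_mul,
        toEuclideanLin_jac]
      rw [← sub_eq_zero] at h2 ⊢
      rw [← neg_eq_zero, ← h2, show (t : ℕ) = i from rfl]
      abel
    have hcoef : Matrix.toEuclideanLin (D.coef C z (i + 1) hi l) w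
        = Matrix.toEuclideanLin (A l) w - Matrix.toEuclideanLin (D.gain C z t A l)
          (Matrix.toEuclideanLin (D.obsCoef z t A + select m d (.obs t)) w) := by
      rw [← toEuclideanLin_mul, ← LinearMap.sub_apply, ← map_sub]
      rfl
    have hmean' : D.mean u C z (i + 1) hi l
        = a l + Matrix.toEuclideanLin (D.gain C z t A l) (D.innovation u z t a) := rfl
    rw [hcoef, hmean', hinn, ← hpre l hl]
    abel

/-- The columns of `Q`, as perturbations, satisfy the linearized model equations at the times below
`p` and reproduce the predicted observations below `q`, the states being `A l * Q`; and they have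
no model errors from `p'` on and no observation errors from `q'` on. -/
structure Consistent (z : Trajectory k m) (A : ℕ → Matrix (Fin m) (Idx m d) ℝ) (p p' q q' : ℕ)
    {κ : Type} (Q : Matrix (Idx m d) κ ℝ) : Prop where
  init : select m d .init * Q = A 0 * Q
  model : ∀ t : Fin k, t < p → select m d (.model t) * Q
    = A (t + 1) * Q - jac (D.model t) (z t.castSucc) * (A t * Q)
  model_zero : ∀ t : Fin k, p' ≤ t → select m d (.model t) * Q = 0
  obs : ∀ t : Fin k, t < q → select m d (.obs t) * Q
    = -(jac (D.augObsOp t) (z t.succ) * (A (t + 1) * Q))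
  obs_zero : ∀ t : Fin k, q' ≤ t → select m d (.obs t) * Q = 0

namespace Consistent

variable {D} {z : Trajectory k m} {A : ℕ → Matrix (Fin m) (Idx m d) ℝ} {p p' q q' : ℕ} {κ κ' : Type}
  {Q Q' : Matrix (Idx m d) κ ℝ}

theorem add (h : D.Consistent z A p p' q q' Q) (h' : D.Consistent z A p p' q q' Q') :
    D.Consistent z A p p' q q' (Q + Q') where
  init := by simp only [Matrix.mul_add, h.init, h'.init]
  model t ht := by simp only [Matrix.mul_add, h.model t ht, h'.model t ht]; abel
  model_zero t ht := by simp only [Matrix.mul_add, h.model_zero t ht, h'.model_zero t ht, add_zero]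
  obs t ht := by simp only [Matrix.mul_add, h.obs t ht, h'.obs t ht]; abel
  obs_zero t ht := by simp only [Matrix.mul_add, h.obs_zero t ht, h'.obs_zero t ht, add_zero]

theorem zero : D.Consistent z A p p' q q' (0 : Matrix (Idx m d) κ ℝ) := by
  constructor <;> simp

theorem sum {ι : Type} [Fintype ι] {Q : ι → Matrix (Idx m d) κ ℝ}
    (h : ∀ l, D.Consistent z A p p' q q' (Q l)) : D.Consistent z A p p' q q' (∑ l, Q l) :=
  Finset.sum_induction _ _ (fun _ _ => add) zero fun l _ => h l

theorem mul_right [Fintype κ] (h : D.Consistent z A p p' q q' Q) (M : Matrix κ κ' ℝ) :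
    D.Consistent z A p p' q q' (Q * M) where
  init := by simp only [← Matrix.mul_assoc, h.init]
  model t ht := by
    rw [← Matrix.mul_assoc, h.model t ht]
    simp only [Matrix.sub_mul, Matrix.mul_assoc]
  model_zero t ht := by rw [← Matrix.mul_assoc, h.model_zero t ht, Matrix.zero_mul]
  obs t ht := by
    rw [← Matrix.mul_assoc, h.obs t ht]
    simp only [Matrix.neg_mul, Matrix.mul_assoc]
  obs_zero t ht := by rw [← Matrix.mul_assoc, h.obs_zero t ht, Matrix.zero_mul]

theorem mono {p'' q'' : ℕ} (h : D.Consistent z A p p' q q' Q) (hp : p' ≤ p'') (hq : q' ≤ q'') :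
    D.Consistent z A p p'' q q'' Q :=
  ⟨h.init, h.model, fun t ht => h.model_zero t (hp.trans ht), h.obs,
    fun t ht => h.obs_zero t (hq.trans ht)⟩

/-- Passing to the forecast coefficients gives one more model equation. -/
theorem forecast {t : Fin k} (h : D.Consistent z A t p' t q' Q) :
    D.Consistent z (D.forecastCoef z t A) (t + 1) p' t q' Q := by
  have hA : ∀ l : ℕ, l ≤ t → D.forecastCoef z t A l = A l := fun l hl =>
    Function.update_of_ne (by omega) _ _
  refine ⟨?_, fun s hs => ?_, h.model_zero, fun s hs => ?_, h.obs_zero⟩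
  · rw [hA 0 (Nat.zero_le _), h.init]
  · rcases (Nat.lt_succ_iff.1 hs).lt_or_eq with hst | hst
    · rw [hA s hst.le, hA (s + 1) hst, h.model s hst]
    · obtain rfl : s = t := Fin.ext hst
      rw [hA s le_rfl, forecastCoef, Function.update_self, Matrix.add_mul, Matrix.mul_assoc,
        add_sub_cancel_left]
  · rw [hA (s + 1) hs, h.obs s hs]

end Consistent

/-! ### Covariances with the smoothed states solve the tangent equations. -/

section Covariance

variable {D} {z : Trajectory k m} {A : ℕ → Matrix (Fin m) (Idx m d) ℝ}
  {C : Matrix (Idx m d) (Idx m d) ℝ} (hCt : C.transpose = C)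
  (hoff : ∀ c c', c ≠ c' → select m d c * (C * (select m d c').transpose) = 0)

include hCt in
theorem mul_cov_transpose_eq_zero {ι κ : Type} {A : Matrix ι (Idx m d) ℝ}
    {B : Matrix κ (Idx m d) ℝ} (h : A * (C * B.transpose) = 0) : B * (C * A.transpose) = 0 := by
  have h' := congrArg Matrix.transpose h
  simpa [Matrix.transpose_mul, hCt, Matrix.mul_assoc] using h'

include hoff in
-- A perturbation that has not yet entered the states is uncorrelated with them and with the other
-- perturbations, so every equation reads `0 = 0`.
theorem consistent_select {p p' q q' : ℕ} {c : Source k} (hinit : c ≠ .init)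
    (hp : ∀ t : Fin k, c = .model t → p ≤ t ∧ t < p')
    (hq : ∀ t : Fin k, c = .obs t → q ≤ t ∧ t < q')
    (hA : ∀ l : ℕ, l ≤ p → A l * (C * (select m d c).transpose) = 0)
    (hqp : q ≤ p) :
    D.Consistent z A p p' q q' (C * (select m d c).transpose) := by
  refine ⟨?_, fun t ht => ?_, fun t ht => ?_, fun t ht => ?_, fun t ht => ?_⟩
  · rw [hoff _ _ hinit.symm, hA 0 (Nat.zero_le _)]
  · rw [hoff _ _ fun h => absurd (hp t h.symm).1 (by omega), hA _ ht, hA _ ht.le]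
    simp
  · exact hoff _ _ fun h => absurd (hp t h.symm).2 (by omega)
  · rw [hoff _ _ fun h => absurd (hq t h.symm).1 (by omega), hA _ (by omega)]
    simp
  · exact hoff _ _ fun h => absurd (hq t h.symm).2 (by omega)

include hCt hoff in
-- The new state combines the old one, whose covariances are consistent by hypothesis, with a model
-- error that has not entered before; the model equation at `t` is the definition of the forecast
-- coefficient.
theorem consistent_forecast {t : Fin k}
    (h : ∀ l : ℕ, l ≤ t → D.Consistent z A t t t t (C * (A l).transpose)) (l : ℕ)
    (hl : l ≤ t + 1) :
    D.Consistent z (D.forecastCoef z t A) (t + 1) (t + 1) t t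
      (C * (D.forecastCoef z t A l).transpose) := by
  refine Consistent.forecast ?_
  have h' : ∀ l : ℕ, l ≤ t → D.Consistent z A t (t + 1) t t (C * (A l).transpose) := fun l hl =>
    (h l hl).mono (Nat.le_succ _) le_rfl
  rcases hl.lt_or_eq with hlt | rfl
  · rw [forecastCoef, Function.update_of_ne hlt.ne]
    exact h' l (by omega)
  · rw [forecastCoef, Function.update_self, Matrix.transpose_add, Matrix.transpose_mul,
      Matrix.mul_add, ← Matrix.mul_assoc]
    refine ((h' t le_rfl).mul_right _).add (consistent_select hoff (by simp) ?_ (by simp) ?_ le_rfl)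
    · intro s hs
      obtain rfl : t = s := by simpa using hs
      omega
    · intro l hl
      exact mul_cov_transpose_eq_zero hCt ((h l hl).model_zero t le_rfl)

include hCt hoff in
-- The Kalman gain makes the updated states uncorrelated with the innovation, whose coefficient is
-- `-(G + σ)`. This orthogonality is the observation equation at time `t`, and it also lets the
-- earlier equations pass from `A` to `A'`.
theorem consistent_analysis {t : Fin k}
    (hobs : select m d (.obs t) * (C * (select m d (.obs t)).transpose) = D.augR t)
    (hS : IsUnit (D.obsCoef z t A * C * (D.obsCoef z t A).transpose + D.augR t).det)
    (h : ∀ l : ℕ, l ≤ t + 1 → D.Consistent z A (t + 1) (t + 1) t t (C * (A l).transpose)) (l : ℕ)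
    (hl : l ≤ t + 1) {A' : ℕ → Matrix (Fin m) (Idx m d) ℝ}
    (hA' : ∀ l, A' l = A l - D.gain C z t A l * (D.obsCoef z t A + select m d (.obs t))) :
    D.Consistent z A' (t + 1) (t + 1) (t + 1) (t + 1) (C * (A' l).transpose) := by
  set G := D.obsCoef z t A with hG
  set σ : Matrix (Fin (d t) ⊕ Fin m) (Idx m d) ℝ := select m d (.obs t) with hσ
  have h0 : ∀ l : ℕ, l ≤ t + 1 → σ * (C * (A l).transpose) = 0 := fun l hl =>
    (h l hl).obs_zero t le_rfl
  have h0' : ∀ l : ℕ, l ≤ t + 1 → A l * (C * σ.transpose) = 0 := fun l hl =>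
    mul_cov_transpose_eq_zero hCt (h0 l hl)
  have hGσ : G * (C * σ.transpose) = 0 := by
    rw [hG, obsCoef, Matrix.mul_assoc, h0' _ le_rfl, Matrix.mul_zero]
  have hσG : σ * (C * G.transpose) = 0 := mul_cov_transpose_eq_zero hCt hGσ
  have hkey' : A' l * (C * (G + σ).transpose) = 0 := by
    have h1 : (G + σ) * (C * (G + σ).transpose) = G * C * G.transpose + D.augR t := by
      simp only [Matrix.transpose_add, Matrix.mul_add, Matrix.add_mul, hGσ, hσG, hobs]
      simp [Matrix.mul_assoc]
    have h2 : A l * (C * (G + σ).transpose) = A l * C * G.transpose := by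
      simp only [Matrix.transpose_add, Matrix.mul_add, h0' l hl, add_zero, Matrix.mul_assoc]
    rw [hA', Matrix.sub_mul, Matrix.mul_assoc, h1, h2, gain, ← hG, Matrix.mul_assoc _ _⁻¹,
      Matrix.nonsing_inv_mul _ hS, Matrix.mul_one, sub_self]
  have hkey : (G + σ) * (C * (A' l).transpose) = 0 := mul_cov_transpose_eq_zero hCt hkey'
  -- `A'` and `A` differ by a multiple of `G + σ`, which annihilates these columns.
  have hsame : ∀ l', A' l' * (C * (A' l).transpose) = A l' * (C * (A' l).transpose) := fun l' => by
    rw [hA' l', Matrix.sub_mul, Matrix.mul_assoc, hkey, Matrix.mul_zero, sub_zero]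
  have hcons : D.Consistent z A (t + 1) (t + 1) t (t + 1) (C * (A' l).transpose) := by
    have hQ : C * (A' l).transpose = C * (A l).transpose
        + (C * (A (t + 1)).transpose * ((jac (D.augObsOp t) (z t.succ)).transpose
            * (-D.gain C z t A l).transpose)
          + C * σ.transpose * (-D.gain C z t A l).transpose) := by
      rw [hA', hG, obsCoef]
      simp only [Matrix.transpose_sub, Matrix.transpose_mul, Matrix.transpose_add, Matrix.mul_sub,
        Matrix.mul_add, Matrix.transpose_neg, Matrix.mul_neg, Matrix.mul_assoc]
      abel
    rw [hQ]
    refine ((h l hl).mono le_rfl (Nat.le_succ _)).add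
      ((((h _ le_rfl).mono le_rfl (Nat.le_succ _)).mul_right _).add (Consistent.mul_right ?_ _))
    refine consistent_select hoff (by simp) (by simp) ?_ h0' (Nat.le_succ _)
    intro s hs
    obtain rfl : t = s := by simpa using hs
    omega
  refine ⟨?_, fun s hs => ?_, hcons.model_zero, fun s hs => ?_, hcons.obs_zero⟩
  · rw [hsame, hcons.init]
  · rw [hsame, hsame, hcons.model s hs]
  · rw [hsame]
    rcases (Nat.lt_succ_iff.1 hs).lt_or_eq with hst | hst
    · exact hcons.obs s hst
    · obtain rfl : s = t := Fin.ext hst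
      rw [Matrix.add_mul, add_comm, hG, obsCoef, Matrix.mul_assoc] at hkey
      exact eq_neg_of_add_eq_zero_left hkey

include hCt hoff in
theorem consistent_coef
    (hobs : ∀ t, select m d (.obs t) * (C * (select m d (.obs t)).transpose) = D.augR t)
    (hR : ∀ i, (D.R i).PosDef) (hγ : 0 < D.γ) (hC : C.PosSemidef)
    (i : ℕ) (hi : i ≤ k) (l : ℕ) (hl : l ≤ i) :
    D.Consistent z (D.coef C z i hi) i i i i (C * (D.coef C z i hi l).transpose) := by
  induction i generalizing l with
  | zero =>
    exact ⟨rfl, fun t ht => absurd ht (Nat.not_lt_zero _), fun t _ => hoff _ _ (by simp),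
      fun t ht => absurd ht (Nat.not_lt_zero _), fun t _ => hoff _ _ (by simp)⟩
  | succ i ih =>
    exact consistent_analysis (t := ⟨i, hi⟩) hCt hoff (hobs _)
      (D.gain_posDef hR hγ hC z _ _).det_pos.ne'.isUnit
      (consistent_forecast (t := ⟨i, hi⟩) hCt hoff (ih (Nat.le_of_succ_le hi))) l hl
      fun l => rfl

end Covariance

end Problem

/-! ### The objective as a weighted distance between perturbations. -/

namespace Problem

variable (D : Problem k m d)

/-- The covariance of the perturbation of each kind. -/
def noiseCov : (c : Source k) → Matrix (c.Coord m d) (c.Coord m d) ℝ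
  | .init => D.B
  | .model t => D.Q t
  | .obs t => D.augR t

/-- The mean of the perturbation of each kind. -/
def noiseMean : (c : Source k) → Noise m d c
  | .init => D.xb
  | .model _ => 0
  | .obs _ => 0

/-- The covariance of all perturbations of one member. -/
def totalCov : Matrix (Idx m d) (Idx m d) ℝ := Matrix.blockDiagonal' D.noiseCov

theorem noiseCov_posDef (hB : D.B.PosDef) (hQ : ∀ i, (D.Q i).PosDef) (hR : ∀ i, (D.R i).PosDef)
    (hγ : 0 < D.γ) : ∀ c, (D.noiseCov c).PosDef
  | .init => hB
  | .model t => hQ t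
  | .obs t => D.augR_posDef hR hγ t

open Matrix in
theorem _root_.EnKS.dotProduct_blockDiagonal'_mulVec
    (M : (c : Source k) → Matrix (c.Coord m d) (c.Coord m d) ℝ)
    (v w : Idx m d → ℝ) :
    v ⬝ᵥ (Matrix.blockDiagonal' M).mulVec w
      = ∑ c, (fun a => v ⟨c, a⟩) ⬝ᵥ (M c).mulVec (fun a => w ⟨c, a⟩) := by
  rw [dotProduct, Fintype.sum_sigma]
  refine Finset.sum_congr rfl fun c _ => Finset.sum_congr rfl fun a _ => ?_
  congr 1
  rw [Matrix.mulVec, dotProduct, Fintype.sum_sigma, Finset.sum_eq_single c]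
  · simp [Matrix.mulVec, dotProduct, Matrix.blockDiagonal'_apply_eq]
  · intro c' _ hc
    exact Finset.sum_eq_zero fun b _ => by
      rw [Matrix.blockDiagonal'_apply_ne _ _ _ hc.symm, zero_mul]
  · simp

theorem _root_.EnKS.posDef_blockDiagonal'
    {M : (c : Source k) → Matrix (c.Coord m d) (c.Coord m d) ℝ} (hM : ∀ c, (M c).PosDef) :
    (Matrix.blockDiagonal' M).PosDef := by
  refine Matrix.PosDef.of_dotProduct_mulVec_pos ?_ fun x hx => ?_
  · rw [Matrix.IsHermitian, Matrix.blockDiagonal'_conjTranspose]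
    congr 1
    funext c
    exact (hM c).1.eq
  · rw [dotProduct_blockDiagonal'_mulVec]
    obtain ⟨⟨c, a⟩, hca⟩ := Function.ne_iff.1 hx
    refine Finset.sum_pos' (fun c _ => ?_) ⟨c, Finset.mem_univ _, ?_⟩
    · exact (hM c).posSemidef.dotProduct_mulVec_nonneg _
    · exact (hM c).dotProduct_mulVec_pos (x := fun a => x ⟨c, a⟩) fun h => hca (congrFun h a)

theorem _root_.EnKS.select_mul_mul_transpose (C : Matrix (Idx m d) (Idx m d) ℝ) (c c' : Source k) :
    select m d c * (C * (select m d c').transpose) = C.submatrix (Sigma.mk c) (Sigma.mk c') := by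
  ext a b
  simp [select, Matrix.mul_apply, Matrix.one_apply]

theorem _root_.EnKS.inv_blockDiagonal'
    {M : (c : Source k) → Matrix (c.Coord m d) (c.Coord m d) ℝ} (hM : ∀ c, (M c).PosDef) :
    (Matrix.blockDiagonal' M)⁻¹ = Matrix.blockDiagonal' fun c => (M c)⁻¹ := by
  refine Matrix.inv_eq_right_inv ?_
  rw [← Matrix.blockDiagonal'_mul, ← Matrix.blockDiagonal'_one]
  congr 1
  funext c
  exact Matrix.mul_nonsing_inv _ (hM c).det_pos.ne'.isUnit

/-- The Levenberg–Marquardt penalty is the misfit of an additional observation of the state itself,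
with covariance `γ⁻¹ I`. -/
theorem wsq_inv_augR (hR : ∀ i, (D.R i).PosDef) (hγ : 0 < D.γ) (t : Fin k)
    (v : EuclideanSpace ℝ (Fin (d t))) (w : State m) :
    wsq (D.augR t)⁻¹ (stack v w) = wsq (D.R t)⁻¹ v + D.γ * ‖w‖ ^ 2 := by
  rw [D.inv_augR hR hγ, wsq, stack, Matrix.fromBlocks_mulVec, EuclideanSpace.norm_sq_eq]
  simp [wsq, dotProduct, Fintype.sum_sum_type, Matrix.smul_mulVec, Finset.mul_sum,
    Function.comp_def]
  exact Finset.sum_congr rfl fun _ _ => by ring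

theorem _root_.EnKS.stack_sub {a b : ℕ} (v v' : EuclideanSpace ℝ (Fin a)) (w w' : State b) :
    stack v w - stack v' w' = stack (v - v') (w - w') := by
  ext r
  rcases r with r | r <;> rfl

/-- The objective is the weighted distance of the perturbations from their means. -/
theorem objective_eq (hB : D.B.PosDef) (hQ : ∀ i, (D.Q i).PosDef) (hR : ∀ i, (D.R i).PosDef)
    (hγ : 0 < D.γ) (hobs : ∀ i, ContDiff ℝ 1 (D.obsOp i)) (z x : Trajectory k m) :
    D.objective z x = wsq D.totalCov⁻¹ (flat (D.noiseOf z x) - flat D.noiseMean) := by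
  rw [wsq, totalCov, inv_blockDiagonal' (D.noiseCov_posDef hB hQ hR hγ),
    dotProduct_blockDiagonal'_mulVec]
  have h : ∀ c, (fun a => (flat (D.noiseOf z x) - flat D.noiseMean).ofLp ⟨c, a⟩) ⬝ᵥ
      ((D.noiseCov c)⁻¹).mulVec
        (fun a => (flat (D.noiseOf z x) - flat D.noiseMean).ofLp ⟨c, a⟩)
      = wsq (D.noiseCov c)⁻¹ (D.noiseOf z x c - D.noiseMean c) := fun c => rfl
  simp only [h]
  rw [Source.sum_eq, objective, add_assoc, ← Finset.sum_add_distrib]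
  congr 1
  · congr 1
    refine Finset.sum_congr rfl fun t _ => ?_
    change _ = wsq (D.Q t)⁻¹ (D.noiseOf z x (.model t) - 0)
    have h1 : D.noiseOf z x (.model t) - 0 = x t.succ - D.model t (z t.castSucc)
        - fderiv ℝ (D.model t) (z t.castSucc) (x t.castSucc - z t.castSucc) - D.μ t := by
      simp only [noiseOf]
      abel
    rw [h1]
  · refine Finset.sum_congr rfl fun t _ => ?_
    change _ = wsq (D.augR t)⁻¹ (D.noiseOf z x (.obs t) - 0)
    have h1 : D.noiseOf z x (.obs t) - 0 = stack (D.y t - D.obsOp t (z t.succ)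
          - fderiv ℝ (D.obsOp t) (z t.succ) (x t.succ - z t.succ)) (-(x t.succ - z t.succ)) := by
      simp only [noiseOf, D.fderiv_augObsOp hobs, augObsOp, stack_sub, sub_zero, sub_self, zero_sub]
    rw [h1, D.wsq_inv_augR hR hγ, norm_neg]

/-- The Kalman smoother estimate for the problem linearized at `z`. -/
def estimate (z : Trajectory k m) : Trajectory k m :=
  WithLp.toLp 2 fun l => D.mean (flat D.noiseMean) D.totalCov z k le_rfl l

open Matrix in
theorem _root_.EnKS.wsq_add {ι : Type} [Fintype ι] {M : Matrix ι ι ℝ} (hM : M.transpose = M)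
    (v w : EuclideanSpace ℝ ι) :
    wsq M (v + w) = wsq M v + wsq M w + 2 * (w.ofLp ⬝ᵥ M.mulVec v.ofLp) := by
  have h : v.ofLp ⬝ᵥ M.mulVec w.ofLp = w.ofLp ⬝ᵥ M.mulVec v.ofLp := by
    rw [Matrix.dotProduct_mulVec, ← Matrix.mulVec_transpose, hM, dotProduct_comm]
  simp only [wsq, WithLp.ofLp_add, Matrix.mulVec_add, dotProduct_add, add_dotProduct, h]
  ring

/-! ### The smoother estimate is the unique minimizer. -/

section Minimizer

variable {D} (hB : D.B.PosDef) (hQ : ∀ i, (D.Q i).PosDef) (hR : ∀ i, (D.R i).PosDef)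
    (hγ : 0 < D.γ)

/-- Subtracting `mean_add_coef_noiseOf` for two trajectories cancels the mean, so the final
coefficients are a left inverse of the linear part of `noiseOf z`. -/
theorem coef_noiseOf_sub (z x x' : Trajectory k m) (l : Fin (k + 1)) :
    Matrix.toEuclideanLin (D.coef D.totalCov z k le_rfl l)
      (flat (D.noiseOf z x) - flat (D.noiseOf z x')) = x l - x' l := by
  have h1 := D.mean_add_coef_noiseOf 0 D.totalCov z x k le_rfl l (Nat.lt_succ_iff.1 l.isLt)
  have h2 := D.mean_add_coef_noiseOf 0 D.totalCov z x' k le_rfl l (Nat.lt_succ_iff.1 l.isLt)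
  rw [show x l = _ from h1.symm, show x' l = _ from h2.symm, map_sub]
  simp

/-- A vector that is consistent with the states it generates is given by these states. -/
theorem eq_noiseOf_sub_of_consistent {z : Trajectory k m}
    {A : ℕ → Matrix (Fin m) (Idx m d) ℝ} {Q : Matrix (Idx m d) Unit ℝ}
    (hQ : D.Consistent z A k k k k Q) (x x' : Trajectory k m)
    (hx : ∀ l : Fin (k + 1), (x l - x' l).ofLp = fun a => (A l * Q) a ()) :
    (flat (D.noiseOf z x) - flat (D.noiseOf z x')).ofLp = fun p => Q p () := by
  have hlin : ∀ {κ : Type} (J : Matrix κ (Fin m) ℝ) (l : Fin (k + 1)) (a : κ),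
      Matrix.toEuclideanLin J (x l - x' l) a = (J * (A l * Q)) a () := by
    intro κ J l a
    rw [Matrix.toLpLin_apply, hx]
    rfl
  have hsel : ∀ c (a : c.Coord m d), Q ⟨c, a⟩ () = (select m d c * Q) a () := by
    intro c a
    simp [select, Matrix.mul_apply, Matrix.one_apply]
  funext p
  rcases p with ⟨c, a⟩
  change (D.noiseOf z x c - D.noiseOf z x' c) a = Q ⟨c, a⟩ ()
  rw [hsel]
  cases c with
  | init =>
    rw [hQ.init]
    exact congrFun (hx 0) a
  | model t =>
    rw [hQ.model t t.isLt]
    have h1 : D.noiseOf z x (.model t) - D.noiseOf z x' (.model t) = (x t.succ - x' t.succ)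
        - Matrix.toEuclideanLin (jac (D.model t) (z t.castSucc))
          (x t.castSucc - x' t.castSucc) := by
      rw [toEuclideanLin_jac]
      simp only [noiseOf, map_sub]
      abel
    rw [h1]
    have h2 := congrFun (hx t.succ) a
    have h3 := hlin (jac (D.model t) (z t.castSucc)) t.castSucc a
    exact congrArg₂ (· - ·) h2 h3
  | obs t =>
    rw [hQ.obs t t.isLt]
    have h1 : D.noiseOf z x (.obs t) - D.noiseOf z x' (.obs t)
        = -Matrix.toEuclideanLin (jac (D.augObsOp t) (z t.succ)) (x t.succ - x' t.succ) := by
      rw [toEuclideanLin_jac]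
      simp only [noiseOf, map_sub]
      abel
    rw [h1]
    exact congrArg Neg.neg (hlin (jac (D.augObsOp t) (z t.succ)) t.succ a)

include hB hQ hR hγ

theorem totalCov_posDef : D.totalCov.PosDef := posDef_blockDiagonal' (D.noiseCov_posDef hB hQ hR hγ)

/-- The covariances of the perturbations with the smoothed states are consistent. -/
theorem consistent_smoother (z : Trajectory k m) (l : Fin (k + 1)) :
    D.Consistent z (D.coef D.totalCov z k le_rfl) k k k k
      (D.totalCov * (D.coef D.totalCov z k le_rfl l).transpose) := by
  refine consistent_coef ?_ ?_ ?_ hR hγ (totalCov_posDef hB hQ hR hγ).posSemidef k le_rfl l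
    (Nat.lt_succ_iff.1 l.isLt)
  · exact (totalCov_posDef hB hQ hR hγ).1.eq
  · intro c c' hc
    rw [select_mul_mul_transpose]
    ext a b
    exact Matrix.blockDiagonal'_apply_ne _ _ _ hc
  · intro t
    rw [select_mul_mul_transpose]
    ext a b
    exact Matrix.blockDiagonal'_apply_eq _ _ _ _

/-- Differences of trajectories correspond to covariances with the smoothed states. -/
theorem exists_noiseOf_sub_eq (z x x' : Trajectory k m) :
    ∃ c : Fin (k + 1) → Fin m → ℝ, (flat (D.noiseOf z x) - flat (D.noiseOf z x')).ofLp
      = D.totalCov.mulVec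
        (∑ l : Fin (k + 1), (D.coef D.totalCov z k le_rfl l).transpose.mulVec (c l)) := by
  set A := D.coef D.totalCov z k le_rfl
  set C := D.totalCov with hC
  let S : (Fin (k + 1) → Fin m → ℝ) →ₗ[ℝ] (Idx m d → ℝ) :=
    ∑ l : Fin (k + 1), (Matrix.mulVecLin (A l).transpose).comp (LinearMap.proj l)
  have hS : ∀ c, S c = ∑ l : Fin (k + 1), (A l).transpose.mulVec (c l) := fun c => by
    simp [S, Matrix.mulVec_transpose]
  -- With the `A l` stacked into `A`, this is the joint covariance `A C Aᵀ` of the smoothed states;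
  -- its surjectivity represents every difference `x - x'`.
  let T : (Fin (k + 1) → Fin m → ℝ) →ₗ[ℝ] (Fin (k + 1) → Fin m → ℝ) :=
    LinearMap.pi fun l => (Matrix.mulVecLin (A l)).comp ((Matrix.mulVecLin C).comp S)
  have hcons : ∀ c, D.Consistent z A k k k k
      (Matrix.of fun p (_ : Unit) => (C.mulVec (S c)) p) := by
    intro c
    have h : (Matrix.of fun p (_ : Unit) => (C.mulVec (S c)) p) = ∑ l : Fin (k + 1),
        C * (A l).transpose * Matrix.of fun a (_ : Unit) => c l a := by
      rw [hS, Matrix.mulVec_sum]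
      ext p q
      simp only [Matrix.mulVec_mulVec, Matrix.sum_apply, Matrix.of_apply, Finset.sum_apply]
      rfl
    rw [h]
    exact Consistent.sum fun l => (consistent_smoother hB hQ hR hγ z l).mul_right _
  have hrep : ∀ c (x x' : Trajectory k m), (∀ l, (x l - x' l).ofLp = T c l) →
      (flat (D.noiseOf z x) - flat (D.noiseOf z x')).ofLp = C.mulVec (S c) := fun c x x' hx =>
    eq_noiseOf_sub_of_consistent (hcons c) x x' hx
  -- If `T c = 0`, then `C (S c)` is the zero difference of `noiseOf`, hence `S c = 0` as `C` is
  -- invertible. Pairing `S c` with the direction of any `y` gives `∑ y l · c l = 0`; taking `y = c`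
  -- yields `c = 0`.
  have hinj : Function.Injective T := by
    refine (injective_iff_map_eq_zero T).2 fun c hc => ?_
    have h1 : C.mulVec (S c) = 0 := by
      rw [← hrep c 0 0 (by simp [hc])]
      simp
    have h2 : S c = 0 := by
      have hu : IsUnit C.det := (totalCov_posDef hB hQ hR hγ).det_pos.ne'.isUnit
      have := congrArg (C⁻¹).mulVec h1
      simpa [Matrix.mulVec_mulVec, Matrix.nonsing_inv_mul _ hu] using this
    have h3 : ∀ y : Trajectory k m, ∑ l, dotProduct (y l).ofLp (c l) = 0 := by
      intro y
      have h4 : dotProduct (flat (D.noiseOf z y) - flat (D.noiseOf z 0)).ofLp (S c) = 0 := by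
        rw [h2, dotProduct_zero]
      rw [hS, dotProduct_sum] at h4
      rw [← h4]
      refine Finset.sum_congr rfl fun l _ => ?_
      have h5 := coef_noiseOf_sub (D := D) z y 0 l
      rw [Matrix.dotProduct_mulVec, Matrix.vecMul_transpose]
      rw [show (y l).ofLp = (y l - (0 : Trajectory k m) l).ofLp by simp, ← h5,
        Matrix.toLpLin_apply]
    have h6 := h3 (WithLp.toLp 2 fun l => WithLp.toLp 2 (c l))
    funext l
    refine dotProduct_self_eq_zero.1 ((Finset.sum_eq_zero_iff_of_nonneg fun l _ => ?_).1 h6 l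
      (Finset.mem_univ _))
    exact Finset.sum_nonneg fun _ _ => mul_self_nonneg _
  obtain ⟨c, hc⟩ := (LinearMap.injective_iff_surjective.1 hinj) fun l => (x l - x' l).ofLp
  exact ⟨c, by rw [hrep c x x' fun l => (congrFun hc l).symm, hS]⟩

/-- The Kalman smoother estimate is the strict minimizer of the objective. -/
theorem objective_estimate_lt (hobs : ∀ i, ContDiff ℝ 1 (D.obsOp i)) {z x : Trajectory k m}
    (hx : x ≠ D.estimate z) : D.objective z (D.estimate z) < D.objective z x := by
  set xh := D.estimate z with hxh
  set C := D.totalCov with hC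
  have hCp : C.PosDef := totalCov_posDef hB hQ hR hγ
  have hu : IsUnit C.det := hCp.det_pos.ne'.isUnit
  have hCi : C⁻¹.PosDef := hCp.inv
  set w := flat (D.noiseOf z xh) - flat D.noiseMean with hw
  set v := flat (D.noiseOf z x) - flat (D.noiseOf z xh) with hv
  -- Applied to `xh`, the identity reads `xh + A w = xh`, since the mean is `xh` by definition.
  have hAw : ∀ l : Fin (k + 1), (D.coef C z k le_rfl l).mulVec w.ofLp = 0 := by
    intro l
    have h := D.mean_add_coef_noiseOf (flat D.noiseMean) C z xh k le_rfl l
      (Nat.lt_succ_iff.1 l.isLt)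
    have h1 : Matrix.toEuclideanLin (D.coef C z k le_rfl l) w = 0 := by
      have h2 : D.mean (flat D.noiseMean) C z k le_rfl l = xh l := rfl
      rw [h2] at h
      exact add_eq_left.1 h
    simpa [Matrix.toLpLin_apply] using h1
  -- In `v = C ∑ (A l)ᵀ c l` the factor `C` cancels `C⁻¹`, leaving `∑ c l · A l w`.
  have hcross : dotProduct v.ofLp (C⁻¹.mulVec w.ofLp) = 0 := by
    obtain ⟨c, hc⟩ := exists_noiseOf_sub_eq hB hQ hR hγ z x xh
    rw [hv, hc, Matrix.dotProduct_mulVec, ← Matrix.mulVec_transpose,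
      show (C⁻¹).transpose = C⁻¹ from hCi.1.eq, Matrix.mulVec_mulVec, Matrix.nonsing_inv_mul _ hu,
      Matrix.one_mulVec, sum_dotProduct]
    refine Finset.sum_eq_zero fun l _ => ?_
    rw [Matrix.mulVec_transpose, ← Matrix.dotProduct_mulVec, hAw, dotProduct_zero]
  have hv0 : v.ofLp ≠ 0 := by
    intro h0
    refine hx ?_
    have hv0 : v = 0 := by ext p; exact congrFun h0 p
    ext l : 1
    have h := coef_noiseOf_sub (D := D) z x xh l
    rw [← hv, hv0, map_zero] at h
    exact (sub_eq_zero.1 h.symm)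
  have hpos : 0 < wsq C⁻¹ v := hCi.dotProduct_mulVec_pos hv0
  rw [D.objective_eq hB hQ hR hγ hobs, D.objective_eq hB hQ hR hγ hobs,
    show flat (D.noiseOf z x) - flat D.noiseMean = w + v by rw [hw, hv]; abel,
    wsq_add (M := C⁻¹) hCi.1.eq, hcross]
  linarith

theorem isMinOn_objective_iff (hobs : ∀ i, ContDiff ℝ 1 (D.obsOp i)) (z x : Trajectory k m) :
    IsMinOn (D.objective z) Set.univ x ↔ x = D.estimate z := by
  refine ⟨fun h => ?_, ?_⟩
  · by_contra hx
    exact absurd (h (Set.mem_univ (D.estimate z)))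
      (not_le.2 (objective_estimate_lt hB hQ hR hγ hobs hx))
  · rintro rfl y -
    by_cases hy : y = D.estimate z
    · subst hy
      exact le_refl (D.objective z _)
    · exact (objective_estimate_lt hB hQ hR hγ hobs hy).le

theorem existsUnique_isLMSequence (hobs : ∀ i, ContDiff ℝ 1 (D.obsOp i)) (x0 : Trajectory k m) :
    ∃! x : ℕ → Trajectory k m, D.IsLMSequence x0 x := by
  refine ⟨fun j => D.estimate^[j] x0, ⟨rfl, fun j => ?_⟩, ?_⟩
  · exact (isMinOn_objective_iff hB hQ hR hγ hobs _ _).2 (Function.iterate_succ_apply' _ _ _)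
  · rintro x ⟨h0, hx⟩
    funext j
    induction j with
    | zero => exact h0
    | succ j ih =>
      rw [(isMinOn_objective_iff hB hQ hR hγ hobs _ _).1 (hx j), ih,
        ← Function.iterate_succ_apply' D.estimate]

end Minimizer

end Problem

open MeasureTheory ProbabilityTheory Filter

/-- A countably generated filter reduces the claim to sequences, where almost sure convergence
implies convergence in measure. -/
theorem tendstoInMeasure_of_tendsto_ae' {Ω ι E : Type*} [MeasurableSpace Ω] {P : Measure Ω}
    [IsFiniteMeasure P] [PseudoEMetricSpace E] {F : Filter ι} [F.IsCountablyGenerated]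
    {f : ι → Ω → E} {g : Ω → E} (hf : ∀ᶠ i in F, AEStronglyMeasurable (f i) P)
    (hfg : ∀ᵐ ω ∂P, Tendsto (fun i => f i ω) F (𝓝 (g ω))) : TendstoInMeasure P f F g := by
  intro ε hε
  refine tendsto_of_seq_tendsto fun s hs => ?_
  -- Measurability holds only eventually along the filter, so an initial piece of the sequence is
  -- dropped.
  obtain ⟨n0, hn0⟩ := eventually_atTop.1 (hs.eventually hf)
  have h : TendstoInMeasure P (fun n => f (s (n + n0))) atTop g :=
    tendstoInMeasure_of_tendsto_ae (fun n => hn0 _ (Nat.le_add_left _ _)) <| hfg.mono fun ω hω =>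
      hω.comp (hs.comp (tendsto_add_atTop_nat n0))
  exact (tendsto_add_atTop_iff_nat n0).1 (h ε hε)

/-! ### Strong law for the sample means and covariances. -/

section LawOfLargeNumbers

variable {I : Type}

theorem sampleMean_apply {N : ℕ} (U : ℕ → EuclideanSpace ℝ I) (p : I) :
    sampleMean (fun n : Fin N => U n) p = (∑ n ∈ Finset.range N, U n p) / N := by
  rw [sampleMean, div_eq_inv_mul, ← Fin.sum_univ_eq_sum_range]
  simp

/-- Expanding the centred products reduces the covariance to averages covered by the strong law; `N
/ (N - 1)` is the correction for the unbiased normalization. -/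
theorem sampleOuter_apply {N : ℕ} (hN : N ≠ 0) (U : ℕ → EuclideanSpace ℝ I) (p q : I) :
    sampleOuter (fun n : Fin N => U n - sampleMean fun n : Fin N => U n)
      (fun n : Fin N => U n - sampleMean fun n : Fin N => U n) p q
    = (N / ((N : ℝ) - 1)) * ((∑ n ∈ Finset.range N, U n p * U n q) / N
      - (∑ n ∈ Finset.range N, U n p) / N * ((∑ n ∈ Finset.range N, U n q) / N)) := by
  have hN' : (N : ℝ) ≠ 0 := Nat.cast_ne_zero.2 hN
  have h : sampleOuter (fun n : Fin N => U n - sampleMean fun n : Fin N => U n)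
      (fun n : Fin N => U n - sampleMean fun n : Fin N => U n) p q
      = ((N : ℝ) - 1)⁻¹ * ∑ n ∈ Finset.range N, (U n p - sampleMean (fun n : Fin N => U n) p)
        * (U n q - sampleMean (fun n : Fin N => U n) q) := by
    rw [← Fin.sum_univ_eq_sum_range (fun n => (U n p - sampleMean (fun n : Fin N => U n) p)
        * (U n q - sampleMean (fun n : Fin N => U n) q))]
    simp [sampleOuter, Matrix.sum_apply, Matrix.vecMulVec_apply]
  rw [h, sampleMean_apply, sampleMean_apply]
  simp only [sub_mul, mul_sub, Finset.sum_sub_distrib, ← Finset.mul_sum, ← Finset.sum_mul,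
    Finset.sum_const, Finset.card_range, nsmul_eq_mul]
  field_simp
  ring

theorem tendsto_sampleMean {U : ℕ → EuclideanSpace ℝ I} {μ : EuclideanSpace ℝ I}
    (h : ∀ p, Tendsto (fun N : ℕ => (∑ n ∈ Finset.range N, U n p) / N) atTop (𝓝 (μ p))) :
    Tendsto (fun N : ℕ => sampleMean fun n : Fin N => U n) atTop (𝓝 μ) := by
  have h1 : Tendsto (fun N : ℕ => (sampleMean fun n : Fin N => U n).ofLp) atTop (𝓝 μ.ofLp) :=
    tendsto_pi_nhds.2 fun p => by simpa only [sampleMean_apply] using h p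
  exact ((PiLp.continuous_toLp 2 _).tendsto _).comp h1

theorem tendsto_sampleOuter {U : ℕ → EuclideanSpace ℝ I} {μ : EuclideanSpace ℝ I}
    {C : Matrix I I ℝ}
    (h : ∀ p, Tendsto (fun N : ℕ => (∑ n ∈ Finset.range N, U n p) / N) atTop (𝓝 (μ p)))
    (h2 : ∀ p q, Tendsto (fun N : ℕ => (∑ n ∈ Finset.range N, U n p * U n q) / N) atTop
      (𝓝 (C p q + μ p * μ q))) :
    Tendsto (fun N : ℕ => sampleOuter (fun n : Fin N => U n - sampleMean fun n : Fin N => U n)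
      (fun n : Fin N => U n - sampleMean fun n : Fin N => U n)) atTop (𝓝 C) := by
  refine tendsto_pi_nhds.2 fun p => tendsto_pi_nhds.2 fun q => ?_
  have h1 : Tendsto (fun N : ℕ => (N : ℝ) / ((N : ℝ) - 1)) atTop (𝓝 1) := by
    simpa [sub_eq_add_neg] using tendsto_natCast_div_add_atTop (-1 : ℝ)
  have h3 := h1.mul ((h2 p q).sub ((h p).mul (h q)))
  rw [add_sub_cancel_right, one_mul] at h3
  refine h3.congr' ?_
  filter_upwards [eventually_ne_atTop 0] with N hN
  exact (sampleOuter_apply hN U p q).symm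

end LawOfLargeNumbers

namespace Problem

variable (D : Problem k m d) {Ω : Type*} [MeasurableSpace Ω] {P : Measure Ω}
  {ξ : ℕ → (c : Source k) → Ω → Noise m d c}

theorem _root_.EnKS.measurable_noise_apply (c : Source k) (a : c.Coord m d) :
    Measurable fun v : Noise m d c => v a :=
  (EuclideanSpace.proj (𝕜 := ℝ) a).continuous.measurable

section Moments

variable (hcov : ∀ c, (D.noiseCov c).PosSemidef)
  (hmeas : ∀ n c, Measurable (ξ n c))
  (hlaw : ∀ n c, HasLaw (ξ n c) (multivariateGaussian (D.noiseMean c) (D.noiseCov c)) P)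
  (hindep : iIndepFun (fun p : ℕ × Source k => ξ p.1 p.2) P)

include hlaw in
theorem memLp_noise (n : ℕ) (c : Source k) (a : c.Coord m d) :
    MemLp (fun ω => ξ n c ω a) 2 P := by
  have h : MemLp (fun v : Noise m d c => v a) 2
      (multivariateGaussian (D.noiseMean c) (D.noiseCov c)) :=
    (EuclideanSpace.proj (𝕜 := ℝ) a).comp_memLp' IsGaussian.memLp_two_id
  rw [← (hlaw n c).map_eq] at h
  exact h.comp_of_map (hlaw n c).aemeasurable

include hlaw in
theorem integral_noise (n : ℕ) (c : Source k) (a : c.Coord m d) :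
    ∫ ω, ξ n c ω a ∂P = D.noiseMean c a := by
  have h := (hlaw n c).integral_comp (f := fun v : Noise m d c => v a)
    (measurable_noise_apply c a).aestronglyMeasurable
  rw [show ∫ ω, ξ n c ω a ∂P = _ from h]
  have h2 := (EuclideanSpace.proj (𝕜 := ℝ) a).integral_comp_comm
    (μ := multivariateGaussian (D.noiseMean c) (D.noiseCov c)) IsGaussian.integrable_id
  refine Eq.trans h2 ?_
  rw [show ∫ x, id x ∂multivariateGaussian (D.noiseMean c) (D.noiseCov c) = D.noiseMean c from
    integral_id_multivariateGaussian]
  rfl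

include hcov hlaw hindep in
theorem covariance_noise (n : ℕ) (p q : Idx m d) :
    cov[fun ω => ξ n p.1 ω p.2, fun ω => ξ n q.1 ω q.2; P] = D.totalCov p q := by
  obtain ⟨c, a⟩ := p
  obtain ⟨c', b⟩ := q
  by_cases hc : c = c'
  · subst hc
    rw [totalCov, Matrix.blockDiagonal'_apply_eq, ← covariance_eval_multivariateGaussian
      (μ := D.noiseMean c) (hcov c)]
    exact (hlaw n c).covariance_fun_comp (measurable_noise_apply c a).aemeasurable
      (measurable_noise_apply c b).aemeasurable
  · rw [totalCov, Matrix.blockDiagonal'_apply_ne _ _ _ hc]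
    have h : IndepFun (ξ n c) (ξ n c') P :=
      hindep.indepFun (i := (n, c)) (j := (n, c')) (by simpa using hc)
    exact (h.comp (measurable_noise_apply c a) (measurable_noise_apply c' b)).covariance_eq_zero
      (D.memLp_noise hlaw n c a) (D.memLp_noise hlaw n c' b)

variable [IsProbabilityMeasure P]

include hlaw hindep in
theorem ae_tendsto_average_noise (p : Idx m d) :
    ∀ᵐ ω ∂P, Tendsto (fun N : ℕ => (∑ n ∈ Finset.range N, ξ n p.1 ω p.2) / N) atTop
      (𝓝 (D.noiseMean p.1 p.2)) := by
  rw [← D.integral_noise hlaw 0]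
  refine strong_law_ae_real (fun n ω => ξ n p.1 ω p.2)
    ((D.memLp_noise hlaw 0 p.1 p.2).integrable one_le_two) (fun i j hij => ?_) fun i => ?_
  · have h : IndepFun (ξ i p.1) (ξ j p.1) P :=
      hindep.indepFun (i := (i, p.1)) (j := (j, p.1)) (by simpa using hij)
    exact h.comp (measurable_noise_apply p.1 p.2) (measurable_noise_apply p.1 p.2)
  · exact ((hlaw i p.1).identDistrib (hlaw 0 p.1)).comp (measurable_noise_apply p.1 p.2)

include hcov hmeas hlaw hindep in
theorem ae_tendsto_average_noise_mul (p q : Idx m d) :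
    ∀ᵐ ω ∂P, Tendsto (fun N : ℕ => (∑ n ∈ Finset.range N, ξ n p.1 ω p.2 * ξ n q.1 ω q.2) / N) atTop
      (𝓝 (D.totalCov p q + D.noiseMean p.1 p.2 * D.noiseMean q.1 q.2)) := by
  have hp := D.memLp_noise hlaw 0 p.1 p.2
  have hq := D.memLp_noise hlaw 0 q.1 q.2
  have hE : D.totalCov p q + D.noiseMean p.1 p.2 * D.noiseMean q.1 q.2
      = ∫ ω, ξ 0 p.1 ω p.2 * ξ 0 q.1 ω q.2 ∂P := by
    have h := covariance_eq_sub hp hq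
    rw [D.covariance_noise hcov hlaw hindep 0 p q, D.integral_noise hlaw, D.integral_noise hlaw] at h
    rw [h]
    simp
  rw [hE]
  have hφ : Measurable fun v : Noise m d p.1 × Noise m d q.1 => v.1 p.2 * v.2 q.2 :=
    ((measurable_noise_apply p.1 p.2).comp measurable_fst).mul
      ((measurable_noise_apply q.1 q.2).comp measurable_snd)
  refine strong_law_ae_real (fun n ω => ξ n p.1 ω p.2 * ξ n q.1 ω q.2) (hp.integrable_mul hq)
    (fun i j hij => ?_) fun i => ?_
  -- The strong law for products needs the pairs of members `i ≠ j` to be independent of each other;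
  -- within a member, the two kinds may coincide.
  · have h := hindep.indepFun_prodMk_prodMk (fun p => hmeas p.1 p.2) (i, p.1) (i, q.1) (j, p.1)
      (j, q.1) (by simp [hij]) (by simp [hij]) (by simp [hij]) (by simp [hij])
    exact h.comp hφ hφ
  · obtain ⟨c, a⟩ := p
    obtain ⟨c', b⟩ := q
    by_cases hc : c = c'
    · subst hc
      exact ((hlaw i c).identDistrib (hlaw 0 c)).comp
        ((measurable_noise_apply c a).mul (measurable_noise_apply c b))
    · have h : ∀ n, HasLaw (fun ω => (ξ n c ω, ξ n c' ω))
          ((multivariateGaussian (D.noiseMean c) (D.noiseCov c)).prod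
            (multivariateGaussian (D.noiseMean c') (D.noiseCov c'))) P := fun n =>
        (indepFun_iff_hasLaw_prodMk_prod (hlaw n c) (hlaw n c')).1
          (hindep.indepFun (i := (n, c)) (j := (n, c')) (by simpa using hc))
      exact ((h i).identDistrib (h 0)).comp hφ

include hcov hmeas hlaw hindep in
/-- Almost surely, the sample means and covariances of the perturbations converge. -/
theorem ae_tendsto_sample :
    ∀ᵐ ω ∂P, Tendsto (fun N : ℕ => sampleMean fun n : Fin N => flat fun c => ξ n c ω) atTop
        (𝓝 (flat D.noiseMean)) ∧
      Tendsto (fun N : ℕ => sampleOuter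
        (fun n : Fin N => flat (fun c => ξ n c ω) - sampleMean fun n : Fin N => flat fun c => ξ n c ω)
        (fun n : Fin N => flat (fun c => ξ n c ω) - sampleMean fun n : Fin N => flat fun c => ξ n c ω))
        atTop (𝓝 D.totalCov) := by
  filter_upwards [ae_all_iff.2 (D.ae_tendsto_average_noise hlaw hindep),
    ae_all_iff.2 fun p => ae_all_iff.2
      (D.ae_tendsto_average_noise_mul hcov hmeas hlaw hindep p)] with ω h1 h2
  exact ⟨tendsto_sampleMean (U := fun n => flat fun c => ξ n c ω) h1,
    tendsto_sampleOuter (U := fun n => flat fun c => ξ n c ω) (μ := flat D.noiseMean) h1 h2⟩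

end Moments

/-! ### Convergence of the exact-derivative iterates for one outcome. -/

section Limit

variable {D} (hB : D.B.PosDef) (hQ : ∀ i, (D.Q i).PosDef) (hR : ∀ i, (D.R i).PosDef)
    (hγ : 0 < D.γ) (hmodel : ∀ i, ContDiff ℝ 1 (D.model i))
    (hobs : ∀ i, ContDiff ℝ 1 (D.obsOp i))

include hB hQ hR hγ hmodel hobs in
-- Induction on the iteration: the new iterate is continuous in the sample moments and the previous
-- iterate, and at their limits it equals `estimate (x j)`, the next minimizer.
theorem tendsto_iterateX_zero {x0 : Trajectory k m} {x : ℕ → Trajectory k m}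
    (hx : D.IsLMSequence x0 x) {e : ℕ → ℕ → (c : Source k) → Noise m d c} {J : ℕ}
    (hmean : ∀ j, Tendsto (fun N : ℕ => sampleMean fun n : Fin N => flat (e j n)) atTop
      (𝓝 (flat D.noiseMean)))
    (hcov : ∀ j, Tendsto (fun N : ℕ => sampleOuter
      (fun n : Fin N => flat (e j n) - sampleMean fun n : Fin N => flat (e j n))
      (fun n : Fin N => flat (e j n) - sampleMean fun n : Fin N => flat (e j n))) atTop
      (𝓝 D.totalCov))
    {F : Filter (ℕ → ℕ)} (hF : ∀ l, 1 ≤ l → l ≤ J → Tendsto (fun N : ℕ → ℕ => N l) F atTop)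
    (j : ℕ) (hj : j ≤ J) :
    Tendsto (fun N => D.iterateX 0 N x0 e j) F (𝓝 (x j)) := by
  induction j with
  | zero =>
    rw [hx.1]
    exact tendsto_const_nhds
  | succ j ih =>
    have hN := hF (j + 1) (Nat.le_add_left _ _) hj
    rw [(isMinOn_objective_iff hB hQ hR hγ hobs _ _).1 (hx.2 j)]
    have hg : ContinuousAt (fun q : EuclideanSpace ℝ (Idx m d) × Matrix (Idx m d) (Idx m d) ℝ ×
        Trajectory k m => (WithLp.toLp 2 fun l : Fin (k + 1) =>
          D.mean q.1 q.2.1 q.2.2 k le_rfl l : Trajectory k m))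
        (flat D.noiseMean, D.totalCov, x j) := by
      refine ContinuousAt.comp (g := WithLp.toLp 2) (PiLp.continuous_toLp 2 _).continuousAt
        (continuousAt_pi.2 fun l => ?_)
      exact D.continuousAt_mean (u := fun q : EuclideanSpace ℝ (Idx m d) ×
          Matrix (Idx m d) (Idx m d) ℝ × Trajectory k m => q.1) (C := fun q => q.2.1)
        (z := fun q => q.2.2) hR hγ hmodel hobs continuous_fst.continuousAt
        (continuous_fst.comp continuous_snd).continuousAt (totalCov_posDef hB hQ hR hγ).posSemidef
        (continuous_snd.comp continuous_snd).continuousAt k le_rfl l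
    have ht := hg.tendsto.comp (((hmean (j + 1)).comp hN).prodMk_nhds
      (((hcov (j + 1)).comp hN).prodMk_nhds (ih (by omega))))
    refine ht.congr' ?_
    filter_upwards [hN.eventually_ne_atTop 0] with N hN0
    exact (D.iterateX_zero_succ N x0 e j hN0 (U := fun n => flat (e (j + 1) n)) fun n => rfl).symm

end Limit

end Problem

theorem tendsto_eval_minSizeAtTop {j l : ℕ} (hl : 1 ≤ l) (hlj : l ≤ j) :
    Tendsto (fun N : ℕ → ℕ => N l) (minSizeAtTop j) atTop := by
  refine tendsto_atTop_mono (fun N => ?_) tendsto_comap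
  have h := ciInf_le (f := fun l : Fin j => N ((l : ℕ) + 1)) (OrderBot.bddBelow _) ⟨l - 1, by omega⟩
  simpa [Nat.sub_add_cancel hl] using h

instance (j : ℕ) : (minSizeAtTop j).IsCountablyGenerated :=
  inferInstanceAs (Filter.comap _ _).IsCountablyGenerated

end EnKS
end

theorem mainTheorem4
    {k m : ℕ} {d : Fin k → ℕ} (D : EnKS.Problem k m d)
    (hB : D.B.PosDef) (hQ : ∀ i, (D.Q i).PosDef) (hR : ∀ i, (D.R i).PosDef) (hγ : 0 < D.γ)
    (hmodel : ∀ i, ContDiff ℝ 1 (D.model i)) (hobs : ∀ i, ContDiff ℝ 1 (D.obsOp i))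
    (x0 : EnKS.Trajectory k m)
    {Ω : Type*} [MeasurableSpace Ω] (P : MeasureTheory.Measure Ω)
    [MeasureTheory.IsProbabilityMeasure P]
    -- the perturbation of each kind of member `n` in iteration `j`
    (ξ : (j n : ℕ) → (c : EnKS.Source k) → Ω → EnKS.Noise m d c)
    (hmeas : ∀ j n c, Measurable (ξ j n c))
    (hinit : ∀ j n, ProbabilityTheory.HasLaw (ξ j n .init)
      (ProbabilityTheory.multivariateGaussian D.xb D.B) P)
    (hV : ∀ j n i, ProbabilityTheory.HasLaw (ξ j n (.model i))
      (ProbabilityTheory.multivariateGaussian 0 (D.Q i)) P)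
    (hW : ∀ j n i, ProbabilityTheory.HasLaw (ξ j n (.obs i))
      (ProbabilityTheory.multivariateGaussian 0 (D.augR i)) P)
    -- within each iteration, all perturbations of all members are mutually independent
    (hindep : ∀ j, ProbabilityTheory.iIndepFun
      (fun (p : ℕ × EnKS.Source k) => ξ j p.1 p.2) P) :
    -- the Levenberg–Marquardt iterates are well defined
    (∃! x : ℕ → EnKS.Trajectory k m, D.IsLMSequence x0 x) ∧
    ∀ x : ℕ → EnKS.Trajectory k m, D.IsLMSequence x0 x →
      ∀ j : ℕ, 1 ≤ j →
        ∃ Y : (ℕ → ℕ) → Ω → EnKS.Trajectory k m,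
          (∀ N, Measurable (Y N)) ∧
          -- the inner limit, as the finite difference step tends to zero
          (∀ N : ℕ → ℕ, (∀ l, 1 ≤ l → l ≤ j → 2 ≤ N l) →
            MeasureTheory.TendstoInMeasure P
              (fun (τ : ℝ) ω => D.iterate τ N x0 (fun j n c => ξ j n c ω) j)
              (𝓝[>] 0) (Y N)) ∧
          -- the outer limit, as the smallest ensemble size tends to infinity
          MeasureTheory.TendstoInMeasure P Y (EnKS.minSizeAtTop j) (fun _ => x j) := by
  have hlaw : ∀ j n c, ProbabilityTheory.HasLaw (ξ j n c)
      (ProbabilityTheory.multivariateGaussian (D.noiseMean c) (D.noiseCov c)) P := by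
    intro j n c
    cases c with
    | init => exact hinit j n
    | model i => exact hV j n i
    | obs i => exact hW j n i
  have hcov : ∀ c, (D.noiseCov c).PosSemidef := fun c =>
    (D.noiseCov_posDef hB hQ hR hγ c).posSemidef
  have hξ : Measurable fun ω j n c => ξ j n c ω :=
    measurable_pi_lambda _ fun j => measurable_pi_lambda _ fun n => measurable_pi_lambda _ fun c =>
      hmeas j n c
  -- The iterate is continuous in the whole array of perturbations for the product topology, hence
  -- measurable.
  have hY : ∀ (τ : ℝ) (N : ℕ → ℕ) (j : ℕ),
      Measurable fun ω => D.iterateX τ N x0 (fun j n c => ξ j n c ω) j := by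
    intro τ N j
    have h : Continuous fun e : ℕ → ℕ → (c : EnKS.Source k) → EnKS.Noise m d c =>
        D.iterateX τ N x0 e j :=
      D.continuous_iterateX hR hγ hmodel hobs continuous_const (fun j n c => by fun_prop) N x0 j
    exact h.measurable.comp hξ
  refine ⟨EnKS.Problem.existsUnique_isLMSequence hB hQ hR hγ hobs x0, fun x hx j _ =>
    ⟨fun N ω => D.iterateX 0 N x0 (fun j n c => ξ j n c ω) j, fun N => hY 0 N j, fun N _ => ?_, ?_⟩⟩
  · have hne : ∀ᶠ τ : ℝ in 𝓝[>] 0, τ ≠ 0 := by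
      filter_upwards [self_mem_nhdsWithin] with τ hτ
      exact (Set.mem_Ioi.1 hτ).ne'
    -- Here convergence holds for every outcome, by continuity in `τ` alone.
    refine EnKS.tendstoInMeasure_of_tendsto_ae' ?_ (Filter.Eventually.of_forall fun ω => ?_)
    · filter_upwards [hne] with τ hτ
      simp only [← D.iterateX_of_ne hτ]
      exact (hY τ N j).aestronglyMeasurable
    · have h : Continuous fun τ : ℝ => D.iterateX τ N x0 (fun j n c => ξ j n c ω) j :=
        D.continuous_iterateX hR hγ hmodel hobs continuous_id (fun j n c => continuous_const) N x0 j
      refine ((h.tendsto 0).mono_left nhdsWithin_le_nhds).congr' ?_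
      filter_upwards [hne] with τ hτ
      exact D.iterateX_of_ne hτ _ _ _ _
  · refine EnKS.tendstoInMeasure_of_tendsto_ae'
      (Filter.Eventually.of_forall fun N => (hY 0 N j).aestronglyMeasurable) ?_
    -- The almost sure events of the countably many iterations are intersected, so no independence
    -- across iterations is needed.
    filter_upwards [MeasureTheory.ae_all_iff.2 fun j =>
      D.ae_tendsto_sample hcov (hmeas j) (hlaw j) (hindep j)] with ω hω
    exact EnKS.Problem.tendsto_iterateX_zero hB hQ hR hγ hmodel hobs hx
      (e := fun j n c => ξ j n c ω) (fun j => (hω j).1) (fun j => (hω j).2)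
      (fun l hl hlj => EnKS.tendsto_eval_minSizeAtTop hl hlj) j le_rfl
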